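/- Let $\mathbb S^2\subset\mathbb R^3$ be the unit sphere with its surface measure $dp$ and let $\mathcal P(\mathbb S^2)$ be the set of probability densities on it (nonnegative $f\in L^1(\mathbb S^2)$ with $\int f\,dp=1$). For $\eta\in\mathbb R$ and $f\in\mathcal P(\mathbb S^2)$ put $$\mathcal F(f)=\int_{\mathbb S^2} f(p)\ln f(p)-f(p)\ln\Big(\int_{\mathbb S^2}\big((p\cdot q)^2-\tfrac13\big)f(q)\,dq-\eta\Big)\,dp\in\mathbb R\cup\{+\infty\},$$ where $-\ln$ is extended by $+\infty$ to non-positive arguments and $0\cdot\infty=0$. Call $f\in\mathcal P(\mathbb S^2)$ uniaxial if $f(p)=\tilde f(p\cdot e)$ almost everywhere for some $e\in\mathbb S^2$ and some measurable $\tilde f:[-1,1]\to\mathbb R$. Let $P_2(x)=\tfrac12(3x^2-1)$. A probability density $\hat f$ on $[-1,1]$ is said to solve the uniaxial Euler–Lagrange equation if there are $Z>0$ and $S,l\in\mathbb R$ with $$\hat f(x)=\frac1Z\exp(lP_2(x))\max\big(\tfrac23SP_2(x)-\eta,0\big)\quad(-1\le x\le1),$$ $$S=\int_{-1}^1P_2(x)\hat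 f(x)\,dx,\qquad l=\frac23\int_{-1}^1P_2(x)\,\frac{\hat f(x)}{\frac23SP_2(x)-\eta}\,dx,$$ where the last integrand is read as $0$ where $\hat f=0$. Proposition. (i) Let $1\le r\le\infty$ and let $f\in L^r(\mathbb S^2)$ be uniaxial with $\mathcal F(f)<+\infty$ and an $L^r$-local minimiser among uniaxial densities, i.e. there is $\varepsilon>0$ with $\mathcal F(f)\le\mathcal F(g)$ for every uniaxial $g$ with $\|g-f\|_{L^r}<\varepsilon$. Then there are a solution $\hat f$ of the uniaxial Euler–Lagrange equation and $n\in\mathbb S^2$ such that $f(p)=\frac1{2\pi}\hat f(p\cdot n)$ for almost every $p\in\mathbb S^2$. (ii) If $\hat f$ solves the uniaxial Euler–Lagrange equation and $n\in\mathbb S^2$, then $f(p)=\frac1{2\pi}\hat f(p\cdot n)$ is a probability density on $\mathbb S^2$ that solves the full (biaxial) Euler–Lagrange equation: there are $Z>0$ and traceless symmetric $3\times3$ matrices $Q,\Lambda$ with $$f(p)=\frac1Z\exp(\Lambda p\cdot p)\max(Qp\cdot p-\eta,0)\quad(p\in\mathbb S^2),$$ $$Q=\int_{\mathbb S^2}f(p)\big(p\otimes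 p-\tfrac13I\big)\,dp,\qquad \Lambda=\int_{\mathbb S^2}\frac{f(p)}{Qp\cdot p-\eta}\big(p\otimes p-\tfrac13I\big)\,dp,$$ where the last integrand is read as $0$ where $f=0$. -/

import Mathlib

open MeasureTheory
open scoped ENNReal

noncomputable section

namespace Nematic

/-- The unit sphere of Euclidean three-space. -/
abbrev S2 : Type := Metric.sphere (0 : EuclideanSpace ℝ (Fin 3)) 1

/-- The surface measure of the unit sphere (normalised so that the sphere has area `4 * π`). -/
def surf : Measure S2 := (volume : Measure (EuclideanSpace ℝ (Fin 3))).toSphere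

/-- The scalar product of two points of the sphere. -/
def dot (p q : S2) : ℝ := inner ℝ (p : EuclideanSpace ℝ (Fin 3)) (q : EuclideanSpace ℝ (Fin 3))

/-- `f` is (a representative of) a probability density with respect to `μ`. -/
structure IsProbDensity {α : Type*} [MeasurableSpace α] (μ : Measure α) (f : α → ℝ) : Prop where
  integrable : Integrable f μ
  nonneg : ∀ᵐ x ∂μ, 0 ≤ f x
  integral_eq_one : ∫ x, f x ∂μ = 1

/-- `-ln x`, extended by `+∞` to non-positive arguments. -/
def negLog (x : ℝ) : EReal := if 0 < x then ((-Real.log x : ℝ) : EReal) else ⊤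

/-- The integrand `f(p) ln f(p) - f(p) ln (∫ ((p·q)² - 1/3) f(q) dq - η)` of the free energy.
In `EReal` one has `0 * ⊤ = 0`. -/
def energyDensity (η : ℝ) (f : S2 → ℝ) (p : S2) : EReal :=
  ((f p * Real.log (f p) : ℝ) : EReal)
    + (f p : EReal) * negLog ((∫ q, ((dot p q) ^ 2 - 1 / 3) * f q ∂surf) - η)

/-- The free energy: the extended integral (positive part minus negative part) of `energyDensity`.
For a probability density `f` the negative part has a finite integral, so that the value lies in
`(-∞, +∞]`. -/
def energy (η : ℝ) (f : S2 → ℝ) : EReal :=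
  ((∫⁻ p, (energyDensity η f p).toENNReal ∂surf : ℝ≥0∞) : EReal)
    - ((∫⁻ p, (-energyDensity η f p).toENNReal ∂surf : ℝ≥0∞) : EReal)

/-- Uniaxial probability densities: those that depend (almost everywhere) only on `p · e`, for some
axis `e`, which may vary with the density. -/
def IsUniaxial (f : S2 → ℝ) : Prop :=
  IsProbDensity surf f ∧
    ∃ (g : ℝ → ℝ) (e : S2), Measurable g ∧ ∀ᵐ p ∂surf, f p = g (dot p e)

/-- `f` is an `L^r`-local minimiser, of finite energy, of the free energy among the uniaxial
probability densities. -/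
structure IsUniaxialLocalMin (η : ℝ) (r : ℝ≥0∞) (f : S2 → ℝ) : Prop where
  uniaxial : IsUniaxial f
  memLp : MemLp f r surf
  finite_energy : energy η f < ⊤
  le_energy : ∃ ε : ℝ, 0 < ε ∧ ∀ g : S2 → ℝ, IsUniaxial g →
    eLpNorm (g - f) r surf < ENNReal.ofReal ε → energy η f ≤ energy η g

/-- The second Legendre polynomial. -/
def P2 (x : ℝ) : ℝ := (3 * x ^ 2 - 1) / 2

/-- `h` is a probability density on `[-1, 1]` that solves the uniaxial Euler-Lagrange equation with
normalising constant `Z`, order parameter `S` and multiplier `l`. (The quotient in the last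
equation is `0` wherever `h` vanishes.) -/
structure UniaxialELWith (η : ℝ) (h : ℝ → ℝ) (Z S l : ℝ) : Prop where
  density : IsProbDensity (volume.restrict (Set.Icc (-1 : ℝ) 1)) h
  Z_pos : 0 < Z
  eq_h : ∀ x ∈ Set.Icc (-1 : ℝ) 1,
    h x = Z⁻¹ * Real.exp (l * P2 x) * max (2 / 3 * S * P2 x - η) 0
  eq_S : S = ∫ x in (-1 : ℝ)..1, P2 x * h x
  eq_l : l = 2 / 3 * ∫ x in (-1 : ℝ)..1, P2 x * (h x / (2 / 3 * S * P2 x - η))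

/-- `h` solves the uniaxial Euler-Lagrange equation. -/
def UniaxialEL (η : ℝ) (h : ℝ → ℝ) : Prop := ∃ Z S l : ℝ, UniaxialELWith η h Z S l

/-- The function `p ↦ (2π)⁻¹ h(p · n)` on the sphere. -/
def axial (h : ℝ → ℝ) (n p : S2) : ℝ := (2 * Real.pi)⁻¹ * h (dot p n)

/-- The quadratic form `A p · p`. -/
def quadForm (A : Matrix (Fin 3) (Fin 3) ℝ) (p : S2) : ℝ :=
  ∑ i, ∑ j, A i j * (p : EuclideanSpace ℝ (Fin 3)) i * (p : EuclideanSpace ℝ (Fin 3)) j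

/-- The matrix `p ⊗ p - I / 3`. -/
def tensor (p : S2) : Matrix (Fin 3) (Fin 3) ℝ := fun i j =>
  (p : EuclideanSpace ℝ (Fin 3)) i * (p : EuclideanSpace ℝ (Fin 3)) j
    - if i = j then (1 / 3 : ℝ) else 0

/-- The matrix `∫ g(p) (p ⊗ p - I / 3) dp`, integrated entry by entry. -/
def moment (g : S2 → ℝ) : Matrix (Fin 3) (Fin 3) ℝ := fun i j => ∫ p, g p * tensor p i j ∂surf

/-- `f` solves the full (biaxial) Euler-Lagrange equation with normalising constant `Z`, Q-tensor
`Q` and multiplier `L`. -/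
structure BiaxialELWith (η : ℝ) (f : S2 → ℝ) (Z : ℝ) (Q L : Matrix (Fin 3) (Fin 3) ℝ) : Prop where
  Z_pos : 0 < Z
  symm_Q : Q.IsSymm
  trace_Q : Q.trace = 0
  symm_L : L.IsSymm
  trace_L : L.trace = 0
  eq_f : ∀ p : S2, f p = Z⁻¹ * Real.exp (quadForm L p) * max (quadForm Q p - η) 0
  eq_Q : Q = moment f
  eq_L : L = moment (fun p => f p / (quadForm Q p - η))

/-- `f` solves the full (biaxial) Euler-Lagrange equation. -/
def BiaxialEL (η : ℝ) (f : S2 → ℝ) : Prop :=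
  ∃ (Z : ℝ) (Q L : Matrix (Fin 3) (Fin 3) ℝ), BiaxialELWith η f Z Q L

end Nematic

end

/-!
By Archimedes' hat-box theorem (`map_dot_surf`) the projection `p ↦ p · e` carries the surface
measure of the sphere to `2π` times the Lebesgue measure of `[-1, 1]`, and by symmetry about `e` the
trace-free second moment of a density `F (p · e)` is a multiple of `e ⊗ e - I / 3`
(`integral_dot_mul_traceless`). Hence the second statement is a computation: a solution of the
uniaxial equation with parameters `Z, S, l` solves the biaxial one with `2πZ`,
`Q = S (n ⊗ n - I / 3)` and `Λ = (3 / 2) l (n ⊗ n - I / 3)` (`UniaxialELWith.biaxialEL`).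

For the first statement, the energy of a uniaxial density is, up to the constant `-log (2π)`, equal
to `∫ h log (h / w)` over `[-1, 1]`, where `w = (2 / 3) S P₂ - η` and `S = ∫ P₂ h`. Since `w`
depends on `h` only through `S` and may vanish, the variations are split as follows; all are
uniformly small, so they compete in every `L^r`, the surface measure being finite.

* At fixed mass and `S` and inside `{h > 0}`, a variation along the residual of the weighted
  projection of `log (h / w)` to the span of `1, P₂` shows that `log (h / w)` lies in that span
  (`IsFreeLocalMin.exists_exp`).
* Mass of order `t` placed on `{h = 0, w > 0}` changes the energy by a multiple of `t log t < 0`,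
  which dominates the linear terms, so this set is null (`IsFreeLocalMin.ae_pos`). Thus
  `h = exp (α + β P₂) max (w, 0)`; in particular `h / w` is bounded.
* To change `S`, one cannot simply add a variation to `h`, as the region where `w > 0` may shrink.
  The competitor is instead `exp (α + β P₂) max (w_t, 0)`, with `w_t` the weight for `S + t`,
  corrected by a term of size `O(t)` supported away from the zeros of `w`. Comparing energies up to
  `O(t²)` for both signs of `t` identifies `β` with the derivative at `t = 0` of
  `∫ exp (α + β P₂) max (w_t, 0)`, which is `(2 / 3) ∫ P₂ h / w` (`IsFreeLocalMin.multiplier_eq`).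
-/

namespace Nematic

open Set
open scoped Pointwise

/-! ### The surface measure and its invariance under isometries -/

theorem surf_apply {A : Set S2} (hA : MeasurableSet A) :
    surf A = 3 * volume (Ioo (0 : ℝ) 1 • ((↑) '' A : Set (EuclideanSpace ℝ (Fin 3)))) := by
  rw [surf, Measure.toSphere_apply' _ hA]
  simp

instance : IsFiniteMeasure surf := by unfold surf; infer_instance

theorem continuous_dot (e : S2) : Continuous fun p : S2 => dot p e := by
  unfold dot; fun_prop

theorem measurable_dot (e : S2) : Measurable fun p : S2 => dot p e :=
  (continuous_dot e).measurable

theorem dot_comm (p q : S2) : dot p q = dot q p := real_inner_comm _ _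

theorem dot_self (p : S2) : dot p p = 1 := by
  simp [dot]

theorem dot_mem_Icc (p e : S2) : dot p e ∈ Icc (-1 : ℝ) 1 := by
  have h := abs_real_inner_le_norm (p : EuclideanSpace ℝ (Fin 3)) e
  rw [norm_eq_of_mem_sphere, norm_eq_of_mem_sphere, one_mul] at h
  exact abs_le.mp h

/-- The action of a linear isometry on the unit sphere. -/
noncomputable def rot (R : EuclideanSpace ℝ (Fin 3) ≃ₗᵢ[ℝ] EuclideanSpace ℝ (Fin 3)) (p : S2) :
    S2 :=
  ⟨R p, by simp⟩

theorem measurable_rot (R : EuclideanSpace ℝ (Fin 3) ≃ₗᵢ[ℝ] EuclideanSpace ℝ (Fin 3)) :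
    Measurable (rot R) := by
  apply Measurable.subtype_mk
  exact R.continuous.measurable.comp measurable_subtype_coe

theorem measurePreserving_rot
    (R : EuclideanSpace ℝ (Fin 3) ≃ₗᵢ[ℝ] EuclideanSpace ℝ (Fin 3)) :
    MeasurePreserving (rot R) surf surf := by
  refine ⟨measurable_rot R, Measure.ext fun A hA => ?_⟩
  rw [Measure.map_apply (measurable_rot R) hA, surf_apply hA, surf_apply (measurable_rot R hA)]
  congr 1
  have : (Ioo (0 : ℝ) 1 • ((↑) '' (rot R ⁻¹' A) : Set (EuclideanSpace ℝ (Fin 3)))) =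
      R ⁻¹' (Ioo (0 : ℝ) 1 • ((↑) '' A : Set (EuclideanSpace ℝ (Fin 3)))) := by
    ext x
    simp only [mem_smul, mem_image, mem_preimage]
    constructor
    · rintro ⟨t, ht, _, ⟨p, hp, rfl⟩, rfl⟩
      exact ⟨t, ht, _, ⟨_, hp, rfl⟩, by simp [rot]⟩
    · rintro ⟨t, ht, _, ⟨p, hp, rfl⟩, hx⟩
      refine ⟨t, ht, R.symm p, ⟨rot R.symm p, ?_, rfl⟩, ?_⟩
      · have : rot R (rot R.symm p) = p := Subtype.ext (by simp [rot])
        simpa [this] using hp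
      · apply R.injective
        rw [map_smul, R.apply_symm_apply, hx]
  rw [this]
  exact (R.measurePreserving.measure_preimage_equiv (f := R.toHomeomorph.toMeasurableEquiv) _)

/-- Integration in cylindrical coordinates of a function with rotational symmetry. -/
theorem lintegral_cylindrical (G : ℝ × ℝ → ℝ≥0∞) (hG : Measurable G) :
    ∫⁻ y : Fin 3 → ℝ, G (y 0, √(y 1 ^ 2 + y 2 ^ 2)) =
      ENNReal.ofReal (2 * Real.pi) *
        ∫⁻ q : ℝ × ℝ in univ ×ˢ Ioi 0, ENNReal.ofReal q.2 * G q := by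
  have e1 := (volume_preserving_piFinSuccAbove (fun _ : Fin 3 => ℝ) 0)
  have e2 := (volume_preserving_finTwoArrow ℝ)
  have e3 : MeasurePreserving (fun y : Fin 3 → ℝ => (y 0, (y 1, y 2))) volume volume :=
    ((MeasurePreserving.id volume).prod e2).comp e1
  have h1 : ∫⁻ y : Fin 3 → ℝ, G (y 0, √(y 1 ^ 2 + y 2 ^ 2)) =
      ∫⁻ q : ℝ × (ℝ × ℝ), G (q.1, √(q.2.1 ^ 2 + q.2.2 ^ 2)) := by
    rw [← e3.map_eq, lintegral_map (by fun_prop) e3.measurable]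
  rw [h1, Measure.volume_eq_prod, lintegral_prod _ (by fun_prop), Measure.volume_eq_prod ℝ ℝ,
    ← Measure.prod_restrict, Measure.restrict_univ, lintegral_prod _ (by fun_prop),
    ← lintegral_const_mul _ (by fun_prop)]
  refine lintegral_congr fun z => ?_
  rw [← Measure.volume_eq_prod, ← lintegral_comp_polarCoord_symm, polarCoord_target,
    Measure.volume_eq_prod, ← Measure.prod_restrict]
  have h2 : ∀ᵐ p : ℝ × ℝ ∂((volume.restrict (Ioi (0 : ℝ))).prod
      (volume.restrict (Ioo (-Real.pi) Real.pi))),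
      ENNReal.ofReal p.1 • G (z, √((polarCoord.symm p).1 ^ 2 + (polarCoord.symm p).2 ^ 2)) =
      (ENNReal.ofReal p.1 * G (z, p.1)) * 1 := by
    rw [Measure.prod_restrict]
    filter_upwards [ae_restrict_mem (measurableSet_Ioi.prod measurableSet_Ioo)] with p hp
    have h3 : (polarCoord.symm p).1 ^ 2 + (polarCoord.symm p).2 ^ 2 = p.1 ^ 2 := by
      simp only [polarCoord_symm_apply]
      nlinarith [Real.sin_sq_add_cos_sq p.2]
    rw [h3, Real.sqrt_sq (le_of_lt hp.1), mul_one, smul_eq_mul]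
  rw [lintegral_congr_ae h2, lintegral_prod_mul (f := fun x => ENNReal.ofReal x * G (z, x))
    (g := fun _ => 1) (by fun_prop) (by fun_prop), mul_comm]
  congr 1
  rw [lintegral_one, Measure.restrict_apply_univ, Real.volume_Ioo]
  ring_nf

/-- The cap integral: with `z = cos θ`, Lebesgue measure on `[-1, 1]` is `sin θ dθ` on `(0, π)`. -/
theorem lintegral_sin_indicator (T : Set ℝ) (hT : MeasurableSet T) :
    ∫⁻ θ in Ioo 0 Real.pi, ENNReal.ofReal (Real.sin θ) * T.indicator 1 (Real.cos θ) =
      volume (T ∩ Icc (-1) 1) := by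
  have h := lintegral_image_eq_lintegral_abs_deriv_mul (s := Ioo 0 Real.pi) (f := Real.cos)
    (f' := fun x => -Real.sin x) measurableSet_Ioo
    (fun x _ => (Real.hasDerivAt_cos x).hasDerivWithinAt)
    (Real.injOn_cos.mono Ioo_subset_Icc_self) (T.indicator 1)
  have hcos : Real.cos '' Ioo 0 Real.pi = Ioo (-1) 1 := by
    exact Real.cosPartialHomeomorph.image_source_eq_target
  rw [hcos, lintegral_indicator_one hT, Measure.restrict_apply hT] at h
  have h2 : volume (T ∩ Icc (-1) 1) = volume (T ∩ Ioo (-1 : ℝ) 1) :=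
    measure_congr ((ae_eq_refl T).inter Ioo_ae_eq_Icc.symm)
  rw [h2, h]
  refine setLIntegral_congr_fun measurableSet_Ioo fun x hx => ?_
  simp only [abs_neg, abs_of_pos (Real.sin_pos_of_mem_Ioo hx)]

/-- The planar half of the cone computation, in polar coordinates `z = r cos θ`, `ρ = r sin θ`. -/
theorem lintegral_halfPlane (T : Set ℝ) (hT : MeasurableSet T) :
    ∫⁻ q : ℝ × ℝ in univ ×ˢ Ioi 0, ENNReal.ofReal q.2 *
      {q : ℝ × ℝ | 0 < √(q.1 ^ 2 + q.2 ^ 2) ∧ √(q.1 ^ 2 + q.2 ^ 2) < 1 ∧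
        q.1 / √(q.1 ^ 2 + q.2 ^ 2) ∈ T}.indicator 1 q =
      ENNReal.ofReal (1 / 3) * volume (T ∩ Icc (-1) 1) := by
  rw [← lintegral_indicator (MeasurableSet.univ.prod measurableSet_Ioi),
    ← lintegral_comp_polarCoord_symm, polarCoord_target,
    Measure.volume_eq_prod, ← Measure.prod_restrict]
  have h2 : ∀ᵐ p : ℝ × ℝ ∂((volume.restrict (Ioi (0 : ℝ))).prod
      (volume.restrict (Ioo (-Real.pi) Real.pi))),
      ENNReal.ofReal p.1 • (univ ×ˢ Ioi 0).indicator (fun q : ℝ × ℝ => ENNReal.ofReal q.2 *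
      {q : ℝ × ℝ | 0 < √(q.1 ^ 2 + q.2 ^ 2) ∧ √(q.1 ^ 2 + q.2 ^ 2) < 1 ∧
        q.1 / √(q.1 ^ 2 + q.2 ^ 2) ∈ T}.indicator 1 q) (polarCoord.symm p) =
      ((Ioo (0 : ℝ) 1).indicator (fun r => ENNReal.ofReal (r ^ 2)) p.1) *
      ((Ioo 0 Real.pi).indicator (fun θ => ENNReal.ofReal (Real.sin θ) *
        T.indicator 1 (Real.cos θ)) p.2) := by
    rw [Measure.prod_restrict]
    filter_upwards [ae_restrict_mem (measurableSet_Ioi.prod measurableSet_Ioo)] with p hp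
    have hp1 : 0 < p.1 := hp.1
    have h3 : √((polarCoord.symm p).1 ^ 2 + (polarCoord.symm p).2 ^ 2) = p.1 := by
      rw [Real.sqrt_eq_iff_mul_self_eq (by positivity) hp1.le]
      simp only [polarCoord_symm_apply]
      nlinarith [Real.sin_sq_add_cos_sq p.2]
    have h4 : (polarCoord.symm p).1 / p.1 = Real.cos p.2 := by
      simp only [polarCoord_symm_apply]; field_simp
    have h5 : 0 < (polarCoord.symm p).2 ↔ p.2 ∈ Ioo 0 Real.pi := by
      simp only [polarCoord_symm_apply, mul_pos_iff_of_pos_left hp1]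
      refine ⟨fun h => ⟨?_, hp.2.2⟩, fun h => Real.sin_pos_of_mem_Ioo h⟩
      by_contra hc
      exact absurd (Real.sin_nonpos_of_nonpos_of_neg_pi_le (not_lt.1 hc) hp.2.1.le) (not_le.2 h)
    have h6 : (polarCoord.symm p).2 = p.1 * Real.sin p.2 := rfl
    by_cases hθ : p.2 ∈ Ioo 0 Real.pi
    · rw [indicator_of_mem (by exact ⟨mem_univ _, h5.2 hθ⟩), indicator_of_mem hθ, h6,
        ENNReal.ofReal_mul hp1.le, smul_eq_mul]
      by_cases h1 : p.1 < 1
      · rw [indicator_of_mem (s := Ioo (0 : ℝ) 1) ⟨hp1, h1⟩, sq, ENNReal.ofReal_mul hp1.le]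
        by_cases hc : Real.cos p.2 ∈ T
        · rw [indicator_of_mem, indicator_of_mem hc]
          · simp only [Pi.one_apply]; ring
          · simp only [mem_ofPred_eq, h3, h4]
            exact ⟨hp1, h1, hc⟩
        · rw [indicator_of_notMem, indicator_of_notMem hc]
          · ring
          · simp only [mem_ofPred_eq, h3, h4]
            exact fun h => hc h.2.2
      · rw [indicator_of_notMem (s := Ioo (0 : ℝ) 1) (fun h => h1 h.2), indicator_of_notMem]
        · ring
        · simp only [mem_ofPred_eq, h3, h4]
          exact fun h => h1 h.2.1
    · rw [indicator_of_notMem (fun h => hθ (h5.1 h.2)), indicator_of_notMem hθ]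
      simp
  have hr : ∫⁻ r in Ioi (0 : ℝ), (Ioo (0 : ℝ) 1).indicator (fun r => ENNReal.ofReal (r ^ 2)) r =
      ENNReal.ofReal (1 / 3) := by
    rw [setLIntegral_indicator measurableSet_Ioo, inter_eq_left.2 Ioo_subset_Ioi_self,
      ← ofReal_integral_eq_lintegral_ofReal]
    · rw [← integral_Ioc_eq_integral_Ioo, ← intervalIntegral.integral_of_le zero_le_one]
      norm_num [integral_pow]
    · exact ((continuous_pow 2).integrableOn_Icc (a := (0 : ℝ)) (b := 1)).mono_set
        Ioo_subset_Icc_self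
    · exact ae_of_all _ fun x => sq_nonneg x
  have hθ : ∫⁻ θ in Ioo (-Real.pi) Real.pi,
      (Ioo 0 Real.pi).indicator (fun θ => ENNReal.ofReal (Real.sin θ) *
        T.indicator 1 (Real.cos θ)) θ = volume (T ∩ Icc (-1) 1) := by
    rw [setLIntegral_indicator measurableSet_Ioo, inter_eq_left.2
      (Ioo_subset_Ioo_left (by linarith [Real.pi_pos])), lintegral_sin_indicator T hT]
  rw [lintegral_congr_ae h2, lintegral_prod_mul, hr, hθ]
  · exact (Measurable.indicator (by fun_prop) measurableSet_Ioo).aemeasurable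
  · have : Measurable (T.indicator (1 : ℝ → ℝ≥0∞)) := measurable_one.indicator hT
    exact (Measurable.indicator (by fun_prop) measurableSet_Ioo).aemeasurable

theorem exists_orthonormalBasis_zero_eq (e : S2) :
    ∃ b : OrthonormalBasis (Fin 3) ℝ (EuclideanSpace ℝ (Fin 3)),
    b 0 = e := by
  obtain ⟨b, hb⟩ := Orthonormal.exists_orthonormalBasis_extension_of_card_eq (𝕜 := ℝ)
    (E := EuclideanSpace ℝ (Fin 3)) (ι := Fin 3) (by simp)
    (v := fun _ => (e : EuclideanSpace ℝ (Fin 3))) (s := {0}) (by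
      constructor
      · intro i; simp
      · intro i j hij; exact absurd (Subsingleton.elim i j) hij)
  exact ⟨b, hb 0 rfl⟩

/-- **Archimedes' hat-box theorem**: the projection of the surface measure of the sphere onto an
axis is `2π` times the Lebesgue measure of `[-1, 1]`. -/
theorem map_dot_surf (e : S2) :
    surf.map (fun p => dot p e) =
      ENNReal.ofReal (2 * Real.pi) • volume.restrict (Icc (-1 : ℝ) 1) := by
  refine Measure.ext fun T hT => ?_
  obtain ⟨b, hb⟩ := exists_orthonormalBasis_zero_eq e
  rw [Measure.map_apply (measurable_dot e) hT, surf_apply (measurable_dot e hT),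
    Measure.smul_apply, Measure.restrict_apply hT, smul_eq_mul]
  set S : Set (ℝ × ℝ) := {q : ℝ × ℝ | 0 < √(q.1 ^ 2 + q.2 ^ 2) ∧ √(q.1 ^ 2 + q.2 ^ 2) < 1 ∧
        q.1 / √(q.1 ^ 2 + q.2 ^ 2) ∈ T} with hS
  have hSm : MeasurableSet S := by
    have h1 : Measurable fun q : ℝ × ℝ => √(q.1 ^ 2 + q.2 ^ 2) := by fun_prop
    have h2 : Measurable fun q : ℝ × ℝ => q.1 / √(q.1 ^ 2 + q.2 ^ 2) := by fun_prop
    exact (h1 measurableSet_Ioi).inter ((h1 measurableSet_Iio).inter (h2 hT))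
  have hmp : MeasurePreserving (fun x : EuclideanSpace ℝ (Fin 3) =>
      (fun i => b.repr x i : Fin 3 → ℝ)) volume volume :=
    (EuclideanSpace.volume_preserving_symm_measurableEquiv_toLp (Fin 3)).comp
      b.measurePreserving_repr
  have hmS : Measurable fun y : Fin 3 → ℝ => (y 0, √(y 1 ^ 2 + y 2 ^ 2)) := by fun_prop
  have hset : (Ioo (0 : ℝ) 1 • ((↑) '' ((fun p => dot p e) ⁻¹' T) :
      Set (EuclideanSpace ℝ (Fin 3)))) =
      (fun x : EuclideanSpace ℝ (Fin 3) => (fun i => b.repr x i : Fin 3 → ℝ)) ⁻¹'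
        ((fun y : Fin 3 → ℝ => (y 0, √(y 1 ^ 2 + y 2 ^ 2))) ⁻¹' S) := by
    ext x
    have hn : √((b.repr x 0) ^ 2 + (√((b.repr x 1) ^ 2 + (b.repr x 2) ^ 2)) ^ 2) = ‖x‖ := by
      rw [Real.sq_sqrt (by positivity), ← b.repr.norm_map x, EuclideanSpace.norm_eq,
        Fin.sum_univ_three]
      simp [add_assoc]
    have h0 : b.repr x 0 = inner ℝ x (e : EuclideanSpace ℝ (Fin 3)) := by
      rw [b.repr_apply_apply, hb, real_inner_comm]
    simp only [mem_smul, mem_image, mem_preimage, hS, mem_ofPred_eq, hn]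
    rw [h0]
    constructor
    · rintro ⟨t, ht, _, ⟨p, hp, rfl⟩, rfl⟩
      have h1 : ‖t • (p : EuclideanSpace ℝ (Fin 3))‖ = t := by
        simp [norm_smul, abs_of_pos ht.1]
      refine ⟨by rw [h1]; exact ht.1, by rw [h1]; exact ht.2, ?_⟩
      rw [h1, real_inner_smul_left, mul_div_cancel_left₀ _ ht.1.ne']
      exact hp
    · rintro ⟨h1, h2, h3⟩
      refine ⟨‖x‖, ⟨h1, h2⟩, ‖x‖⁻¹ • x, ⟨⟨‖x‖⁻¹ • x, ?_⟩, ?_, rfl⟩, ?_⟩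
      · simp [norm_smul, h1.ne']
      · simp only [dot, real_inner_smul_left]
        rwa [inv_mul_eq_div]
      · rw [smul_smul, mul_inv_cancel₀ h1.ne', one_smul]
  rw [hset, hmp.measure_preimage (hmS hSm).nullMeasurableSet, ← lintegral_indicator_one (hmS hSm)]
  have := lintegral_cylindrical (S.indicator 1) (measurable_one.indicator hSm)
  rw [lintegral_halfPlane T hT] at this
  have h2 : ∀ y : Fin 3 → ℝ, ((fun y : Fin 3 → ℝ => (y 0, √(y 1 ^ 2 + y 2 ^ 2))) ⁻¹' S).indicator
    (1 : (Fin 3 → ℝ) → ℝ≥0∞) y = S.indicator 1 (y 0, √(y 1 ^ 2 + y 2 ^ 2)) := fun y => rfl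
  simp_rw [h2]
  rw [this, mul_left_comm, ← mul_assoc 3]
  congr 1
  have : (3 : ℝ≥0∞) * ENNReal.ofReal (1 / 3) = 1 := by
    rw [← ENNReal.ofReal_ofNat, ← ENNReal.ofReal_mul (by norm_num)]
    norm_num
  rw [this, one_mul]

/-! ### Integrals and second moments of axially symmetric functions -/

/-- Lebesgue measure on `[-1, 1]`. -/
noncomputable abbrev nu : Measure ℝ := volume.restrict (Icc (-1 : ℝ) 1)

theorem ofReal_two_pi_ne_zero : ENNReal.ofReal (2 * Real.pi) ≠ 0 := by
  simp [Real.pi_pos]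

theorem ae_dot {e : S2} {P : ℝ → Prop} (h : ∀ᵐ x ∂nu, P x) : ∀ᵐ p ∂surf, P (dot p e) := by
  apply ae_of_ae_map (measurable_dot e).aemeasurable
  rw [map_dot_surf e]
  exact Measure.ae_smul_measure h _

theorem ae_nu_of_ae_dot {e : S2} {P : ℝ → Prop} (hP : MeasurableSet {x | P x})
    (h : ∀ᵐ p ∂surf, P (dot p e)) : ∀ᵐ x ∂nu, P x := by
  rw [← ae_map_iff (measurable_dot e).aemeasurable hP, map_dot_surf e,
    ae_iff, Measure.smul_apply, smul_eq_mul] at h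
  exact ae_iff.2 ((mul_eq_zero.1 h).resolve_left ofReal_two_pi_ne_zero)

theorem aestronglyMeasurable_map_dot {F : ℝ → ℝ} (hF : AEStronglyMeasurable F nu) (e : S2) :
    AEStronglyMeasurable F (surf.map fun p => dot p e) := by
  rw [map_dot_surf e]
  exact hF.smul_measure _

theorem integral_dot {F : ℝ → ℝ} (hF : AEStronglyMeasurable F nu) (e : S2) :
    ∫ p, F (dot p e) ∂surf = 2 * Real.pi * ∫ x, F x ∂nu := by
  rw [← integral_map (measurable_dot e).aemeasurable (aestronglyMeasurable_map_dot hF e),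
    map_dot_surf e, integral_smul_measure, ENNReal.toReal_ofReal (by positivity), smul_eq_mul]

theorem integrable_dot_iff {F : ℝ → ℝ} (hF : AEStronglyMeasurable F nu) (e : S2) :
    Integrable (fun p => F (dot p e)) surf ↔ Integrable F nu := by
  have h := integrable_map_measure (aestronglyMeasurable_map_dot hF e)
    (measurable_dot e).aemeasurable
  rw [map_dot_surf e, integrable_smul_measure ofReal_two_pi_ne_zero ENNReal.ofReal_ne_top] at h
  exact h.symm

theorem integrable_continuous_mul_nu {F : ℝ → ℝ} (hF : Integrable F nu) {g : ℝ → ℝ}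
    (hg : Continuous g) :
    Integrable (fun x => g x * F x) nu :=
  IntegrableOn.continuousOn_mul (K := Icc (-1 : ℝ) 1) hg.continuousOn hF isCompact_Icc

/-- The second moment tensor of a density with rotational symmetry about `e`. Off-diagonal terms, in
an orthonormal basis starting with `e`, vanish by reflection, and the two transversal diagonal terms
agree by the reflection that swaps the two transversal basis vectors. -/
theorem integral_dot_mul_mul {F : ℝ → ℝ} (hF : Integrable F nu) (e : S2)
    (u v : EuclideanSpace ℝ (Fin 3)) :
    ∫ p : S2, F (dot p e) * (inner ℝ (p : EuclideanSpace ℝ (Fin 3)) u *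
        inner ℝ (p : EuclideanSpace ℝ (Fin 3)) v) ∂surf =
      2 * Real.pi * ((inner ℝ (e : EuclideanSpace ℝ (Fin 3)) u *
          inner ℝ (e : EuclideanSpace ℝ (Fin 3)) v) * ∫ x, P2 x * F x ∂nu
        + inner ℝ u v * ∫ x, (1 - x ^ 2) / 2 * F x ∂nu) := by
  obtain ⟨b, hb⟩ := exists_orthonormalBasis_zero_eq e
  have hFs : Integrable (fun p => F (dot p e)) surf := (integrable_dot_iff hF.1 e).2 hF
  have hbn : ∀ i, ‖b i‖ = 1 := fun i => b.orthonormal.1 i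
  have hbo : ∀ i j, i ≠ j → inner ℝ (b i) (b j) = 0 := fun i j h => b.orthonormal.2 h
  set I : Fin 3 → Fin 3 → ℝ := fun i j => ∫ p : S2, F (dot p e) *
    (inner ℝ (p : EuclideanSpace ℝ (Fin 3)) (b i) * inner ℝ (p : EuclideanSpace ℝ (Fin 3)) (b j))
      ∂surf with hI
  have hint : ∀ i j, Integrable (fun p : S2 => F (dot p e) *
    (inner ℝ (p : EuclideanSpace ℝ (Fin 3)) (b i) *
      inner ℝ (p : EuclideanSpace ℝ (Fin 3)) (b j))) surf := by
    intro i j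
    refine hFs.mul_bdd (c := 1) (Continuous.aestronglyMeasurable (by fun_prop)) (ae_of_all _ ?_)
    intro p
    have h1 := norm_inner_le_norm (𝕜 := ℝ) (p : EuclideanSpace ℝ (Fin 3)) (b i)
    have h2 := norm_inner_le_norm (𝕜 := ℝ) (p : EuclideanSpace ℝ (Fin 3)) (b j)
    rw [norm_eq_of_mem_sphere, hbn, one_mul] at h1 h2
    rw [norm_mul]
    exact mul_le_one₀ h1 (norm_nonneg _) h2
  have hrefl : ∀ (K : Submodule ℝ (EuclideanSpace ℝ (Fin 3))) (x y : EuclideanSpace ℝ (Fin 3)),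
      inner ℝ (K.reflection x) y = inner ℝ x (K.reflection y) := by
    intro K x y
    rw [← K.reflection.inner_map_map, K.reflection_reflection]
  have hinv : ∀ (K : Submodule ℝ (EuclideanSpace ℝ (Fin 3))), K.reflection (b 0) = b 0 →
      ∀ i j, I i j = ∫ p : S2, F (dot p e) *
        (inner ℝ (p : EuclideanSpace ℝ (Fin 3)) (K.reflection (b i)) *
          inner ℝ (p : EuclideanSpace ℝ (Fin 3)) (K.reflection (b j))) ∂surf := by
    intro K hK i j
    have hmp := measurePreserving_rot K.reflection
    have h1 := integral_map (μ := surf) (φ := rot K.reflection) (measurable_rot _).aemeasurable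
      (f := fun p : S2 => F (dot p e) * (inner ℝ (p : EuclideanSpace ℝ (Fin 3)) (b i) *
        inner ℝ (p : EuclideanSpace ℝ (Fin 3)) (b j))) (by rw [hmp.map_eq]; exact (hint i j).1)
    rw [hmp.map_eq] at h1
    rw [hI]
    simp only
    rw [h1]
    refine integral_congr_ae (ae_of_all _ fun p => ?_)
    simp only [rot, dot, hrefl]
    rw [← hb, hK]
  have hoff : ∀ i j, i ≠ j → I i j = 0 := by
    have key : ∀ i j, i ≠ j → j ≠ 0 → I i j = 0 := by
      intro i j hij hj
      have hfix : ∀ k, k ≠ j → (ℝ ∙ b j)ᗮ.reflection (b k) = b k := fun k hk =>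
        Submodule.reflection_mem_subspace_eq_self
          (Submodule.mem_orthogonal_singleton_iff_inner_right.2 (hbo _ _ hk.symm))
      have h1 := hinv (ℝ ∙ b j)ᗮ (hfix 0 hj.symm) i j
      rw [hfix i hij, Submodule.reflection_orthogonalComplement_singleton_eq_neg] at h1
      simp only [inner_neg_right, mul_neg, integral_neg] at h1
      change I i j = - I i j at h1
      linarith
    have hsymm : ∀ i j, I i j = I j i := fun i j => by
      simp only [hI]
      refine integral_congr_ae (ae_of_all _ fun p => ?_)
      simp only; ring
    intro i j hij
    by_cases hj : j = 0
    · rw [hsymm]; exact key j i hij.symm (fun h => hij (h.trans hj.symm))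
    · exact key i j hij hj
  have hswap : I 1 1 = I 2 2 := by
    have hfix : (ℝ ∙ (b 1 - b 2))ᗮ.reflection (b 0) = b 0 :=
      Submodule.reflection_mem_subspace_eq_self
        (Submodule.mem_orthogonal_singleton_iff_inner_right.2 (by
          rw [inner_sub_left, hbo 1 0 (by decide), hbo 2 0 (by decide), sub_zero]))
    have h1 := hinv _ hfix 1 1
    rw [Submodule.reflection_sub ((hbn 1).trans (hbn 2).symm)] at h1
    exact h1
  have hsum : ∀ p : S2, ∑ i, (inner ℝ (p : EuclideanSpace ℝ (Fin 3)) (b i) *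
      inner ℝ (p : EuclideanSpace ℝ (Fin 3)) (b i)) = 1 := by
    intro p
    have := b.sum_inner_mul_inner (p : EuclideanSpace ℝ (Fin 3)) p
    simp only [real_inner_comm (p : EuclideanSpace ℝ (Fin 3)) (b _)] at this ⊢
    rw [this]; simp
  have h00 : I 0 0 = 2 * Real.pi * ∫ x, x ^ 2 * F x ∂nu := by
    rw [← integral_dot (integrable_continuous_mul_nu hF (continuous_pow 2)).1 e]
    simp only [hI, hb]
    refine integral_congr_ae (ae_of_all _ fun p => ?_)
    simp only [dot]; ring
  have h11 : I 1 1 = 2 * Real.pi * ∫ x, (1 - x ^ 2) / 2 * F x ∂nu := by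
    rw [← integral_dot (integrable_continuous_mul_nu hF (by fun_prop)).1 e]
    have h3 : I 1 1 = (1 / 2) * (I 1 1 + I 2 2) := by rw [← hswap]; ring
    rw [h3]
    simp only [hI]
    rw [← integral_add (hint 1 1) (hint 2 2), ← integral_const_mul]
    refine integral_congr_ae (ae_of_all _ fun p => ?_)
    have h4 := hsum p
    rw [Fin.sum_univ_three, hb] at h4
    have h5 : dot p e = inner ℝ (p : EuclideanSpace ℝ (Fin 3)) (e : EuclideanSpace ℝ (Fin 3)) := rfl
    rw [← h5] at h4
    simp only
    linear_combination (F (dot p e) / 2) * h4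
  have hexp : ∀ p : S2, F (dot p e) * (inner ℝ (p : EuclideanSpace ℝ (Fin 3)) u *
        inner ℝ (p : EuclideanSpace ℝ (Fin 3)) v) = ∑ i, ∑ j, (inner ℝ (b i) u * inner ℝ (b j) v) *
        (F (dot p e) * (inner ℝ (p : EuclideanSpace ℝ (Fin 3)) (b i) *
          inner ℝ (p : EuclideanSpace ℝ (Fin 3)) (b j))) := by
    intro p
    rw [← b.sum_inner_mul_inner (p : EuclideanSpace ℝ (Fin 3)) u,
      ← b.sum_inner_mul_inner (p : EuclideanSpace ℝ (Fin 3)) v, Finset.sum_mul_sum, Finset.mul_sum]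
    refine Finset.sum_congr rfl fun i _ => ?_
    rw [Finset.mul_sum]
    refine Finset.sum_congr rfl fun j _ => ?_
    ring
  have huv := b.sum_inner_mul_inner u v
  simp_rw [hexp]
  rw [integral_finsetSum _ (fun i _ => integrable_finsetSum _ fun j _ => (hint i j).const_mul _)]
  simp_rw [integral_finsetSum _ (fun j _ => (hint _ j).const_mul _), integral_const_mul]
  change ∑ i, ∑ j, (inner ℝ (b i) u * inner ℝ (b j) v) * I i j = _
  simp only [Fin.sum_univ_three] at huv ⊢
  rw [hoff 0 1 (by decide), hoff 0 2 (by decide), hoff 1 0 (by decide), hoff 1 2 (by decide),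
    hoff 2 0 (by decide), hoff 2 1 (by decide), ← hswap, h00, h11, hb]
  rw [hb, real_inner_comm (e : EuclideanSpace ℝ (Fin 3)) u, real_inner_comm (b 1) u,
    real_inner_comm (b 2) u] at huv
  have hP : ∫ x, P2 x * F x ∂nu = ∫ x, x ^ 2 * F x ∂nu - ∫ x, (1 - x ^ 2) / 2 * F x ∂nu := by
    rw [← integral_sub (integrable_continuous_mul_nu hF (by fun_prop))
      (integrable_continuous_mul_nu hF (by fun_prop))]
    refine integral_congr_ae (ae_of_all _ fun x => ?_)
    simp only [P2]; ring
  rw [hP]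
  linear_combination (2 * Real.pi * ∫ x, (1 - x ^ 2) / 2 * F x ∂nu) * huv

/-- The trace-free second moment `∫ F(p·e) (p·u p·v - u·v/3) dp`. -/
theorem integral_dot_mul_traceless {F : ℝ → ℝ} (hF : Integrable F nu) (e : S2)
    (u v : EuclideanSpace ℝ (Fin 3)) :
    ∫ p : S2, F (dot p e) * (inner ℝ (p : EuclideanSpace ℝ (Fin 3)) u *
        inner ℝ (p : EuclideanSpace ℝ (Fin 3)) v - inner ℝ u v / 3) ∂surf =
      2 * Real.pi * (inner ℝ (e : EuclideanSpace ℝ (Fin 3)) u *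
          inner ℝ (e : EuclideanSpace ℝ (Fin 3)) v - inner ℝ u v / 3) * ∫ x, P2 x * F x ∂nu := by
  have hFs : Integrable (fun p => F (dot p e)) surf := (integrable_dot_iff hF.1 e).2 hF
  have hb : Integrable (fun p : S2 => F (dot p e) * (inner ℝ (p : EuclideanSpace ℝ (Fin 3)) u *
        inner ℝ (p : EuclideanSpace ℝ (Fin 3)) v)) surf := by
    refine hFs.mul_bdd (c := ‖u‖ * ‖v‖) (Continuous.aestronglyMeasurable (by fun_prop))
      (ae_of_all _ fun p => ?_)
    have h1 := norm_inner_le_norm (𝕜 := ℝ) (p : EuclideanSpace ℝ (Fin 3)) u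
    have h2 := norm_inner_le_norm (𝕜 := ℝ) (p : EuclideanSpace ℝ (Fin 3)) v
    rw [norm_eq_of_mem_sphere, one_mul] at h1 h2
    rw [norm_mul]
    gcongr
  simp_rw [mul_sub]
  rw [integral_sub hb (hFs.mul_const _), integral_dot_mul_mul hF, integral_mul_const,
    integral_dot hF.1]
  have hP : ∫ x, (1 - x ^ 2) / 2 * F x ∂nu = (1 / 3) * ∫ x, F x ∂nu
      - (1 / 3) * ∫ x, P2 x * F x ∂nu := by
    rw [← integral_const_mul, ← integral_const_mul, ← integral_sub (hF.const_mul _)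
      ((integrable_continuous_mul_nu hF (by unfold P2; fun_prop)).const_mul _)]
    refine integral_congr_ae (ae_of_all _ fun x => ?_)
    simp only [P2]; ring
  rw [hP]
  ring

/-! ### The free energy on the interval -/

/-- The scalar order parameter `∫ P₂ h` of a density on `[-1, 1]`. -/
noncomputable def order (h : ℝ → ℝ) : ℝ := ∫ x, P2 x * h x ∂nu

/-- The argument of the singular logarithm in the uniaxial energy. -/
noncomputable def weight (η S x : ℝ) : ℝ := 2 / 3 * S * P2 x - η

/-- Densities on `[-1, 1]` of finite uniaxial energy, normalised to satisfy the sign conditions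
everywhere on `[-1, 1]`. -/
structure Admissible (η : ℝ) (h : ℝ → ℝ) : Prop where
  measurable : Measurable h
  nonneg : ∀ x ∈ Icc (-1 : ℝ) 1, 0 ≤ h x
  integrable : Integrable h nu
  integral_eq_one : ∫ x, h x ∂nu = 1
  weight_pos : ∀ x ∈ Icc (-1 : ℝ) 1, 0 < h x → 0 < weight η (order h) x
  integrable_log : Integrable (fun x => h x * Real.log (h x / weight η (order h) x)) nu

/-- The uniaxial free energy, up to an additive constant. -/
noncomputable def free (η : ℝ) (h : ℝ → ℝ) : ℝ :=
  ∫ x, h x * Real.log (h x / weight η (order h) x) ∂nu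

/-- Local minimality of the uniaxial free energy with respect to uniformly small variations. -/
structure IsFreeLocalMin (η : ℝ) (h : ℝ → ℝ) : Prop where
  admissible : Admissible η h
  free_le : ∃ ε : ℝ, 0 < ε ∧ ∀ k, Admissible η k → (∀ᵐ x ∂nu, |k x - h x| ≤ ε) →
    free η h ≤ free η k

@[fun_prop]
theorem continuous_P2 : Continuous P2 := by unfold P2; fun_prop

@[fun_prop]
theorem measurable_P2 : Measurable P2 := continuous_P2.measurable

theorem abs_P2_le {x : ℝ} (hx : x ∈ Icc (-1 : ℝ) 1) : |P2 x| ≤ 1 := by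
  have : x ^ 2 ≤ 1 := by nlinarith [hx.1, hx.2]
  rw [abs_le]; unfold P2
  constructor <;> nlinarith [sq_nonneg x]

@[fun_prop]
theorem continuous_weight (η S : ℝ) : Continuous (weight η S) := by unfold weight; fun_prop

@[fun_prop]
theorem measurable_weight (η S : ℝ) : Measurable (weight η S) := (continuous_weight η S).measurable

theorem ae_mem_nu : ∀ᵐ x ∂nu, x ∈ Icc (-1 : ℝ) 1 := ae_restrict_mem measurableSet_Icc

theorem ae_P2_ne (c : ℝ) : ∀ᵐ x ∂nu, P2 x ≠ c := by
  have hfin : {x : ℝ | P2 x = c}.Finite := by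
    apply Set.Finite.subset (s := {√((2 * c + 1) / 3), -√((2 * c + 1) / 3)}) (by simp)
    intro x hx
    have hx' : (2 * c + 1) / 3 = x ^ 2 := by
      have : P2 x = c := hx
      unfold P2 at this; linarith
    rw [hx', Real.sqrt_sq_eq_abs]
    rcases abs_choice x with h | h <;> simp [h]
  apply ae_restrict_of_ae
  exact ae_iff.2 (by simpa using hfin.measure_zero volume)

theorem integrable_nu_of_bound {f : ℝ → ℝ} (hf : Measurable f) (C : ℝ)
    (hC : ∀ x ∈ Icc (-1 : ℝ) 1, |f x| ≤ C) : Integrable f nu :=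
  Integrable.of_bound hf.aestronglyMeasurable C (by
    filter_upwards [ae_mem_nu] with x hx using hC x hx)

theorem integrable_nu_of_continuous {f : ℝ → ℝ} (hf : Continuous f) : Integrable f nu :=
  hf.continuousOn.integrableOn_compact isCompact_Icc

theorem integral_nu_const (c : ℝ) : ∫ _, c ∂nu = 2 * c := by
  simp; norm_num

/-! ### Perturbations preserving mass and order parameter -/

/-- For a nonnegative nonzero weight `ρ`, the functionals `φ ↦ ∫ φ` and `φ ↦ ∫ P₂ φ` are linearly
independent on the multiples `ρ (a + b P₂)`: the Gram determinant of `1, P₂` is positive by the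
strict Cauchy-Schwarz inequality. -/
theorem exists_dual {ρ : ℝ → ℝ} (hρ0 : ∀ x ∈ Icc (-1 : ℝ) 1, 0 ≤ ρ x) (hρ : Integrable ρ nu)
    (hpos : 0 < ∫ x, ρ x ∂nu) : ∃ C : ℝ, 0 ≤ C ∧ ∀ r₁ r₂ : ℝ, ∃ a b : ℝ,
      |a| ≤ C * (|r₁| + |r₂|) ∧ |b| ≤ C * (|r₁| + |r₂|) ∧
      ∫ x, ρ x * (a + b * P2 x) ∂nu = r₁ ∧ ∫ x, P2 x * (ρ x * (a + b * P2 x)) ∂nu = r₂ := by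
  have hρ1 : Integrable (fun x => P2 x * ρ x) nu := integrable_continuous_mul_nu hρ continuous_P2
  have hρ2 : Integrable (fun x => P2 x * (P2 x * ρ x)) nu :=
    integrable_continuous_mul_nu hρ1 continuous_P2
  set m₀ := ∫ x, ρ x ∂nu with hm₀
  set m₁ := ∫ x, P2 x * ρ x ∂nu with hm₁
  set m₂ := ∫ x, P2 x * (P2 x * ρ x) ∂nu with hm₂
  have hlin : ∀ a b : ℝ, ∫ x, ρ x * (a + b * P2 x) ∂nu = a * m₀ + b * m₁ := fun a b => by
    rw [hm₀, hm₁, ← integral_const_mul, ← integral_const_mul, ← integral_add (hρ.const_mul _)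
      (hρ1.const_mul _)]
    congr 1; ext x; ring
  have hlin2 : ∀ a b : ℝ, ∫ x, P2 x * (ρ x * (a + b * P2 x)) ∂nu = a * m₁ + b * m₂ := fun a b => by
    rw [hm₁, hm₂, ← integral_const_mul, ← integral_const_mul, ← integral_add (hρ1.const_mul _)
      (hρ2.const_mul _)]
    congr 1; ext x; ring
  have hdet : 0 < m₀ * m₂ - m₁ ^ 2 := by
    set c := m₁ / m₀ with hc
    have hsq : Integrable (fun x => ρ x * (P2 x - c) ^ 2) nu := by
      have := integrable_continuous_mul_nu hρ (g := fun x => (P2 x - c) ^ 2) (by fun_prop)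
      simpa [mul_comm] using this
    have h0 : 0 ≤ᵐ[nu] fun x => ρ x * (P2 x - c) ^ 2 := by
      filter_upwards [ae_mem_nu] with x hx using mul_nonneg (hρ0 x hx) (sq_nonneg _)
    have h1 : ∫ x, ρ x * (P2 x - c) ^ 2 ∂nu = m₂ - 2 * c * m₁ + c ^ 2 * m₀ := by
      have h2 : Integrable (fun x => P2 x * (ρ x * (-2 * c + 1 * P2 x))) nu := by
        have := integrable_continuous_mul_nu hρ
          (g := fun x => P2 x * (-2 * c + 1 * P2 x)) (by fun_prop)
        refine this.congr (ae_of_all _ fun x => ?_)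
        simp only; ring
      have h3 : m₂ - 2 * c * m₁ + c ^ 2 * m₀ = (-2 * c * m₁ + 1 * m₂) + c ^ 2 * m₀ := by ring
      rw [h3, ← hlin2, hm₀, ← integral_const_mul, ← integral_add h2 (hρ.const_mul _)]
      congr 1; ext x; ring
    have h2 : 0 < ∫ x, ρ x * (P2 x - c) ^ 2 ∂nu := by
      refine lt_of_le_of_ne (integral_nonneg_of_ae h0) fun h => hpos.ne' ?_
      have h3 := (integral_eq_zero_iff_of_nonneg_ae h0 hsq).1 h.symm
      rw [hm₀, ← integral_zero ℝ ℝ (μ := nu)]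
      refine integral_congr_ae ?_
      filter_upwards [h3, ae_P2_ne c] with x hx hne
      exact (mul_eq_zero.1 hx).resolve_right (pow_ne_zero 2 (sub_ne_zero.2 hne))
    rw [h1] at h2
    have h4 : m₀ * (m₂ - 2 * c * m₁ + c ^ 2 * m₀) = m₀ * m₂ - m₁ ^ 2 := by
      rw [hc]; field_simp; ring
    rw [← h4]
    exact mul_pos hpos h2
  set d := m₀ * m₂ - m₁ ^ 2 with hd
  refine ⟨(|m₀| + |m₁| + |m₂|) / d, by positivity, fun r₁ r₂ =>
    ⟨(m₂ * r₁ - m₁ * r₂) / d, (m₀ * r₂ - m₁ * r₁) / d, ?_, ?_, ?_, ?_⟩⟩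
  · rw [abs_div, abs_of_pos hdet, div_mul_eq_mul_div]
    gcongr
    refine (abs_sub _ _).trans ?_
    rw [abs_mul, abs_mul]
    nlinarith [abs_nonneg m₀, abs_nonneg m₁, abs_nonneg m₂, abs_nonneg r₁, abs_nonneg r₂]
  · rw [abs_div, abs_of_pos hdet, div_mul_eq_mul_div]
    gcongr
    refine (abs_sub _ _).trans ?_
    rw [abs_mul, abs_mul]
    nlinarith [abs_nonneg m₀, abs_nonneg m₁, abs_nonneg m₂, abs_nonneg r₁, abs_nonneg r₂]
  · rw [hlin]; field_simp; rw [hd]; ring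
  · rw [hlin2]; field_simp; rw [hd]; ring

/-- The pointwise estimate behind the variations: relative perturbations of size at most `1/2`
change `h log (h / w)` by at most the first variation plus a quadratic remainder. -/
theorem mul_log_div_add_le {h w φ : ℝ} (hh : 0 < h) (hw : 0 < w) (hφ : |φ| ≤ h / 2) :
    (h + φ) * Real.log ((h + φ) / w) ≤
      h * Real.log (h / w) + φ * Real.log (h / w) + φ + φ ^ 2 / h := by
  have hk : 0 < h + φ := by linarith [neg_abs_le φ]
  have h1 : Real.log ((h + φ) / w) = Real.log (h / w) + Real.log ((h + φ) / h) := by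
    rw [← Real.log_mul (by positivity) (by positivity)]
    congr 1; field_simp
  have h2 := Real.log_le_sub_one_of_pos (div_pos hk hh)
  rw [h1]
  have h3 : (h + φ) * Real.log ((h + φ) / h) ≤ (h + φ) * ((h + φ) / h - 1) := by gcongr
  have h4 : (h + φ) * ((h + φ) / h - 1) = φ + φ ^ 2 / h := by field_simp; ring
  linarith

theorem abs_mul_log_div_add_le {h w φ : ℝ} (hh : 0 < h) (hw : 0 < w) (hφ : |φ| ≤ h / 2) :
    |(h + φ) * Real.log ((h + φ) / w)| ≤ 3 / 2 * |h * Real.log (h / w)| + 3 / 2 * h := by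
  have hk : 0 < h + φ := by linarith [neg_abs_le φ]
  have hk2 : h + φ ≤ 3 / 2 * h := by linarith [le_abs_self φ]
  have hk3 : h / 2 ≤ h + φ := by linarith [neg_abs_le φ]
  have h1 : Real.log ((h + φ) / w) = Real.log (h / w) + Real.log ((h + φ) / h) := by
    rw [← Real.log_mul (by positivity) (by positivity)]
    congr 1; field_simp
  have h2 := Real.log_le_sub_one_of_pos (div_pos hk hh)
  have h3 := Real.one_sub_inv_le_log_of_pos (div_pos hk hh)
  have h4 : |Real.log ((h + φ) / h)| ≤ 1 := by
    rw [abs_le]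
    constructor
    · have : ((h + φ) / h)⁻¹ ≤ 2 := by
        rw [inv_div, div_le_iff₀ hk]; linarith
      linarith
    · have : (h + φ) / h ≤ 2 := by rw [div_le_iff₀ hh]; linarith
      linarith
  rw [abs_mul, abs_of_pos hk, abs_mul, abs_of_pos hh, h1]
  calc (h + φ) * |Real.log (h / w) + Real.log ((h + φ) / h)|
      ≤ (3 / 2 * h) * (|Real.log (h / w)| + 1) := by
        gcongr
        exact (abs_add_le _ _).trans (by gcongr)
    _ = _ := by ring

/-- Comparison, for small `t > 0`, of a local minimiser `h` with `h + t φ`, where `φ` preserves mass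
and order parameter, is at most a multiple of `h` on `{h > 0}`, and is either `0` or the weight `w`
on `{h = 0}`. The latter choice makes the energy density of `h + t φ` there exactly `t log t φ`. Any
integrable upper bound `R` of the change of the energy density has nonnegative integral. -/
theorem IsFreeLocalMin.le_of_perturbation {η : ℝ} {h φ : ℝ → ℝ} (hm : IsFreeLocalMin η h)
    (hφm : Measurable φ) {M : ℝ} (hφb : ∀ x ∈ Icc (-1 : ℝ) 1, |φ x| ≤ M)
    (hφ0 : ∫ x, φ x ∂nu = 0) (hφ2 : ∫ x, P2 x * φ x ∂nu = 0)
    (hpos : ∀ x ∈ Icc (-1 : ℝ) 1, 0 < h x → |φ x| ≤ M * h x)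
    (hzero : ∀ x ∈ Icc (-1 : ℝ) 1, h x = 0 → 0 ≤ φ x ∧
      (0 < φ x → φ x = weight η (order h) x)) :
    ∃ t₀ > 0, ∀ t, 0 < t → t ≤ t₀ → ∀ R : ℝ → ℝ, Integrable R nu →
      (∀ᵐ x ∂nu, 0 < h x → t * (φ x * Real.log (h x / weight η (order h) x)) + t * φ x
        + t ^ 2 * (φ x ^ 2 / h x) ≤ R x) →
      (∀ᵐ x ∂nu, h x = 0 → t * Real.log t * φ x ≤ R x) → 0 ≤ ∫ x, R x ∂nu := by
  obtain ⟨ha, ε, hε, hmin⟩ := hm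
  have hM : 0 ≤ M := (abs_nonneg _).trans (hφb 0 (by norm_num))
  refine ⟨min (1 / (2 * (M + 1))) (ε / (M + 1)), by positivity, fun t ht htle R hR hR1 hR2 => ?_⟩
  have htM : t * M ≤ 1 / 2 := by
    have := htle.trans (min_le_left _ _)
    rw [le_div_iff₀ (by positivity)] at this
    nlinarith
  have htε : t * M ≤ ε := by
    have := htle.trans (min_le_right _ _)
    rw [le_div_iff₀ (by positivity)] at this
    nlinarith
  have hφi : Integrable φ nu := integrable_nu_of_bound hφm M hφb
  set k : ℝ → ℝ := fun x => h x + t * φ x with hk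
  have hhalf : ∀ x ∈ Icc (-1 : ℝ) 1, 0 < h x → |t * φ x| ≤ h x / 2 := by
    intro x hx hx0
    rw [abs_mul, abs_of_pos ht]
    nlinarith [hpos x hx hx0]
  have hord : order k = order h := by
    have : order k = order h + t * ∫ x, P2 x * φ x ∂nu := by
      rw [order, order, ← integral_const_mul, ← integral_add
        (integrable_continuous_mul_nu ha.integrable continuous_P2)
        ((integrable_continuous_mul_nu hφi continuous_P2).const_mul _)]
      congr 1; ext x; simp only [hk]; ring
    rw [this, hφ2]; ring
  have hcase : ∀ x ∈ Icc (-1 : ℝ) 1, 0 < h x ∨ h x = 0 := fun x hx => by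
    rcases (ha.nonneg x hx).lt_or_eq with h | h
    · exact Or.inl h
    · exact Or.inr h.symm
  have hzk : ∀ x ∈ Icc (-1 : ℝ) 1, h x = 0 →
      k x * Real.log (k x / weight η (order h) x) = t * Real.log t * φ x := by
    intro x hx hx0
    obtain ⟨h1, h2⟩ := hzero x hx hx0
    simp only [hk, hx0, zero_add]
    rcases h1.lt_or_eq with h3 | h3
    · rw [← h2 h3, mul_div_cancel_right₀ _ h3.ne']; ring
    · simp [← h3]
  have hkm : Measurable k := ha.measurable.add (hφm.const_mul t)
  have hkint : Integrable (fun x => k x * Real.log (k x / weight η (order h) x)) nu := by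
    refine Integrable.mono' (g := fun x => 3 / 2 * |h x * Real.log (h x / weight η (order h) x)|
      + 3 / 2 * h x + |t * Real.log t| * M) ?_ (by fun_prop) ?_
    · exact ((ha.integrable_log.abs.const_mul _).add (ha.integrable.const_mul _)).add
        (integrable_const _)
    · filter_upwards [ae_mem_nu] with x hx
      rw [Real.norm_eq_abs]
      rcases hcase x hx with hx0 | hx0
      · have := abs_mul_log_div_add_le hx0 (ha.weight_pos x hx hx0) (hhalf x hx hx0)
        have : 0 ≤ |t * Real.log t| * M := by positivity
        linarith
      · rw [hzk x hx hx0, abs_mul, hx0]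
        have := mul_le_mul_of_nonneg_left (hφb x hx) (abs_nonneg (t * Real.log t))
        simpa using this
  have hadm : Admissible η k := by
    refine ⟨hkm, fun x hx => ?_, ha.integrable.add (hφi.const_mul t), ?_, fun x hx hkx => ?_, ?_⟩
    · rcases hcase x hx with hx0 | hx0
      · have := neg_abs_le (t * φ x)
        have := hhalf x hx hx0
        simp only [hk]; linarith
      · simp only [hk, hx0, zero_add]
        exact mul_nonneg ht.le (hzero x hx hx0).1
    · simp only [hk]
      rw [integral_add ha.integrable (hφi.const_mul t), integral_const_mul, hφ0,
        ha.integral_eq_one]; ring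
    · rw [hord]
      rcases hcase x hx with hx0 | hx0
      · exact ha.weight_pos x hx hx0
      · have hφx : 0 < φ x := by
          simp only [hk, hx0, zero_add] at hkx
          exact pos_of_mul_pos_right hkx ht.le
        rw [← (hzero x hx hx0).2 hφx]; exact hφx
    · rw [hord]; exact hkint
  have hle := hmin k hadm (by
    filter_upwards [ae_mem_nu] with x hx
    simp only [hk, add_sub_cancel_left, abs_mul, abs_of_pos ht]
    exact (mul_le_mul_of_nonneg_left (hφb x hx) ht.le).trans htε)
  rw [free, free, hord, ← sub_nonneg, ← integral_sub hkint ha.integrable_log] at hle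
  refine hle.trans (integral_mono_ae (hkint.sub ha.integrable_log) hR ?_)
  filter_upwards [ae_mem_nu, hR1, hR2] with x hx h1 h2
  rcases hcase x hx with hx0 | hx0
  · have h3 := mul_log_div_add_le hx0 (ha.weight_pos x hx hx0) (hhalf x hx hx0)
    have h4 := h1 hx0
    have h5 : (t * φ x) ^ 2 / h x = t ^ 2 * (φ x ^ 2 / h x) := by rw [mul_pow, mul_div_assoc]
    simp only [hk]
    linarith
  · simp only [hzk x hx hx0, hx0]
    have := h2 hx0
    linarith

/-! ### Variations at fixed order parameter -/

theorem nonpos_of_forall_mul_le_sq {A B t₀ : ℝ} (ht₀ : 0 < t₀)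
    (h : ∀ t, 0 < t → t ≤ t₀ → t * A ≤ t ^ 2 * B) : A ≤ 0 := by
  by_contra hA
  push Not at hA
  set t := min t₀ (A / (2 * (|B| + 1))) with ht
  have htp : 0 < t := lt_min ht₀ (by positivity)
  have h1 := h t htp (min_le_left _ _)
  have h2 : t * (2 * (|B| + 1)) ≤ A := by
    rw [← le_div_iff₀ (by positivity)]; exact min_le_right _ _
  have h3 : A ≤ t * B := by
    rw [sq, mul_assoc] at h1
    exact le_of_mul_le_mul_left h1 htp
  nlinarith [le_abs_self B, abs_nonneg B]

theorem Admissible.integral_pos_of_pos {η : ℝ} {h g : ℝ → ℝ} (ha : Admissible η h)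
    (hg : ∀ x, 0 < h x → 0 < g x) (hg0 : ∀ x ∈ Icc (-1 : ℝ) 1, 0 ≤ g x) (hgi : Integrable g nu) :
    0 < ∫ x, g x ∂nu := by
  have h0 : 0 ≤ᵐ[nu] g := by filter_upwards [ae_mem_nu] with x hx using hg0 x hx
  refine lt_of_le_of_ne (integral_nonneg_of_ae h0) fun heq => ?_
  have h3 := (integral_eq_zero_iff_of_nonneg_ae h0 hgi).1 heq.symm
  have h4 : ∫ x, h x ∂nu = ∫ x, 0 ∂nu := by
    refine integral_congr_ae ?_
    filter_upwards [h3, ae_mem_nu] with x hx hxI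
    by_contra hne
    exact (hg x (lt_of_le_of_ne (ha.nonneg x hxI) (Ne.symm hne))).ne' hx
  rw [ha.integral_eq_one] at h4
  simp at h4

/-- Variations inside `{h > 0}` at fixed mass and order parameter: `log (h / w)` is a combination of
`1` and `P₂`. The variation is the weighted projection residual of `log (h / w)`, the weight being
chosen so that all quantities are bounded. -/
theorem IsFreeLocalMin.exists_exp {η : ℝ} {h : ℝ → ℝ} (hm : IsFreeLocalMin η h) :
    ∃ α β : ℝ, ∀ᵐ x ∂nu, 0 < h x →
      h x = weight η (order h) x * Real.exp (α + β * P2 x) := by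
  have ha := hm.admissible
  set v : ℝ → ℝ := fun x => Real.log (h x / weight η (order h) x) with hv
  have hhm := ha.measurable
  have hvm : Measurable v := by fun_prop
  set σ : ℝ → ℝ := fun x => min (h x) 1 with hσ
  set ρ : ℝ → ℝ := fun x => σ x / (1 + v x ^ 2) with hρ
  have hσm : Measurable σ := by fun_prop
  have hρm : Measurable ρ := by fun_prop
  have hσ0 : ∀ x ∈ Icc (-1 : ℝ) 1, 0 ≤ σ x := fun x hx => le_min (ha.nonneg x hx) zero_le_one
  have hρ0 : ∀ x ∈ Icc (-1 : ℝ) 1, 0 ≤ ρ x := fun x hx => div_nonneg (hσ0 x hx) (by positivity)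
  have hρσ : ∀ x, ρ x * (1 + v x ^ 2) = σ x := fun x => by
    simp only [hρ]; field_simp
  have hρ1 : ∀ x ∈ Icc (-1 : ℝ) 1, ρ x * (1 + v x ^ 2) ≤ 1 := fun x hx => by
    rw [hρσ]; exact min_le_right _ _
  have hρi : Integrable ρ nu := by
    refine integrable_nu_of_bound hρm 1 fun x hx => ?_
    rw [abs_of_nonneg (hρ0 x hx)]
    nlinarith [hρ1 x hx, mul_nonneg (hρ0 x hx) (sq_nonneg (v x))]
  have hρvi : Integrable (fun x => ρ x * v x) nu := by
    refine integrable_nu_of_bound (by fun_prop) 1 fun x hx => ?_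
    rw [abs_mul, abs_of_nonneg (hρ0 x hx)]
    have : |v x| ≤ 1 + v x ^ 2 := by nlinarith [sq_abs (v x), sq_nonneg (|v x| - 1)]
    exact (mul_le_mul_of_nonneg_left this (hρ0 x hx)).trans (hρ1 x hx)
  have hρpos : 0 < ∫ x, ρ x ∂nu := by
    refine ha.integral_pos_of_pos (fun x hx => ?_) hρ0 hρi
    exact div_pos (lt_min hx zero_lt_one) (by positivity)
  obtain ⟨_, _, hdual⟩ := exists_dual hρ0 hρi hρpos
  obtain ⟨α, β, -, -, hα, hβ⟩ := hdual (∫ x, ρ x * v x ∂nu) (∫ x, P2 x * (ρ x * v x) ∂nu)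
  refine ⟨α, β, ?_⟩
  set D : ℝ → ℝ := fun x => v x - (α + β * P2 x) with hD
  have hDm : Measurable D := by fun_prop
  set C : ℝ := 1 + |α| + |β| with hC
  have hC0 : 0 < C := by positivity
  have hDC : ∀ x ∈ Icc (-1 : ℝ) 1, |D x| ≤ C * (1 + v x ^ 2) := fun x hx => by
    have h1 : |v x| ≤ 1 + v x ^ 2 := by nlinarith [sq_abs (v x), sq_nonneg (|v x| - 1)]
    have h2 : |α + β * P2 x| ≤ |α| + |β| := by
      refine (abs_add_le _ _).trans ?_
      rw [abs_mul]
      nlinarith [abs_P2_le hx, abs_nonneg β]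
    have h3 : |D x| ≤ |v x| + |α + β * P2 x| := abs_sub _ _
    nlinarith [sq_nonneg (v x), abs_nonneg α, abs_nonneg β]
  have hDC2 : ∀ x ∈ Icc (-1 : ℝ) 1, D x ^ 2 ≤ 2 * C ^ 2 * (1 + v x ^ 2) := fun x hx => by
    have h2 : |α + β * P2 x| ≤ C := by
      refine (abs_add_le _ _).trans ?_
      rw [abs_mul]
      nlinarith [abs_P2_le hx, abs_nonneg β]
    have h3 : (α + β * P2 x) ^ 2 ≤ C ^ 2 := sq_le_sq' (by linarith [neg_abs_le (α + β * P2 x)])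
      (by linarith [le_abs_self (α + β * P2 x)])
    have h4 : 1 ≤ C ^ 2 := by
      have : 1 ≤ C := by simp only [hC]; linarith [abs_nonneg α, abs_nonneg β]
      nlinarith
    simp only [hD]
    nlinarith [sq_nonneg (v x + (α + β * P2 x)), sq_nonneg (v x)]
  have hρP : Integrable (fun x => ρ x * (α + β * P2 x)) nu := by
    have := integrable_continuous_mul_nu hρi (g := fun x => α + β * P2 x) (by fun_prop)
    simpa [mul_comm] using this
  have hρDi : Integrable (fun x => ρ x * D x) nu := by
    refine (hρvi.sub hρP).congr (ae_of_all _ fun x => ?_)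
    simp only [hD, Pi.sub_apply]; ring
  have hD0 : ∫ x, ρ x * D x ∂nu = 0 := by
    have : ∫ x, ρ x * D x ∂nu = ∫ x, ρ x * v x ∂nu - ∫ x, ρ x * (α + β * P2 x) ∂nu := by
      rw [← integral_sub hρvi hρP]
      congr 1; ext x; simp only [hD]; ring
    rw [this, hα, sub_self]
  have hD2 : ∫ x, P2 x * (ρ x * D x) ∂nu = 0 := by
    have : ∫ x, P2 x * (ρ x * D x) ∂nu =
        ∫ x, P2 x * (ρ x * v x) ∂nu - ∫ x, P2 x * (ρ x * (α + β * P2 x)) ∂nu := by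
      rw [← integral_sub (integrable_continuous_mul_nu hρvi continuous_P2)
        (integrable_continuous_mul_nu hρP continuous_P2)]
      congr 1; ext x; simp only [hD]; ring
    rw [this, hβ, sub_self]
  have hDsqi : Integrable (fun x => ρ x * D x ^ 2) nu := by
    refine integrable_nu_of_bound (by fun_prop) (2 * C ^ 2) fun x hx => ?_
    rw [abs_of_nonneg (mul_nonneg (hρ0 x hx) (sq_nonneg _))]
    calc ρ x * D x ^ 2 ≤ ρ x * (2 * C ^ 2 * (1 + v x ^ 2)) :=
          mul_le_mul_of_nonneg_left (hDC2 x hx) (hρ0 x hx)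
      _ = 2 * C ^ 2 * (ρ x * (1 + v x ^ 2)) := by ring
      _ ≤ 2 * C ^ 2 * 1 := by gcongr; exact hρ1 x hx
      _ = _ := by ring
  have hφσ : ∀ x ∈ Icc (-1 : ℝ) 1, |-(ρ x * D x)| ≤ C * σ x := fun x hx => by
    rw [abs_neg, abs_mul, abs_of_nonneg (hρ0 x hx), ← hρσ]
    have := mul_le_mul_of_nonneg_left (hDC x hx) (hρ0 x hx)
    linarith
  obtain ⟨t₀, ht₀, hvar⟩ := hm.le_of_perturbation (φ := fun x => -(ρ x * D x)) (M := C)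
    (by fun_prop) (fun x hx => (hφσ x hx).trans (by
      have : σ x ≤ 1 := min_le_right _ _
      nlinarith))
    (by rw [integral_neg, hD0, neg_zero])
    (by simp only [mul_neg]; rw [integral_neg, hD2, neg_zero])
    (fun x hx _ => (hφσ x hx).trans (by
      have : σ x ≤ h x := min_le_left _ _
      nlinarith))
    (fun x hx hx0 => by
      have : ρ x = 0 := by simp [hρ, hσ, hx0]
      simp [this])
  -- The first variation in the direction `-ρ D` is `-∫ ρ D v = -∫ ρ D ^ 2`, as `ρ D` is orthogonal
  -- to `1` and `P₂`.
  have hle : ∫ x, ρ x * D x ^ 2 ∂nu ≤ 0 := by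
    refine nonpos_of_forall_mul_le_sq (B := 2 * C ^ 2) ht₀ fun t ht htle => ?_
    set E : ℝ → ℝ := fun x => ρ x * (α + β * P2 x) * D x with hE
    have hEq : ∀ x, E x = α * (ρ x * D x) + β * (P2 x * (ρ x * D x)) := fun x => by
      simp only [hE]; ring
    have hPD := integrable_continuous_mul_nu hρDi continuous_P2
    have hEi : Integrable E nu :=
      ((hρDi.const_mul α).add (hPD.const_mul β)).congr (ae_of_all _ fun x => (hEq x).symm)
    have hE0 : ∫ x, E x ∂nu = 0 := by
      simp_rw [hEq]
      rw [integral_add (hρDi.const_mul α) (hPD.const_mul β), integral_const_mul,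
        integral_const_mul, hD0, hD2]; ring
    have hi1 : Integrable (fun x => (-t) * (ρ x * D x ^ 2) + (-t) * E x) nu :=
      (hDsqi.const_mul _).add (hEi.const_mul _)
    have hi2 : Integrable (fun x => (-t) * (ρ x * D x ^ 2) + (-t) * E x + (-t) * (ρ x * D x)) nu :=
      hi1.add (hρDi.const_mul _)
    have hR := hvar t ht htle
      (fun x => (-t) * (ρ x * D x ^ 2) + (-t) * E x + (-t) * (ρ x * D x) + t ^ 2 * C ^ 2)
      (hi2.add (integrable_const _)) ?_ ?_
    · have h1 : ∫ x, (-t) * (ρ x * D x ^ 2) + (-t) * E x + (-t) * (ρ x * D x) + t ^ 2 * C ^ 2 ∂nu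
          = (-t) * ∫ x, ρ x * D x ^ 2 ∂nu + 2 * (t ^ 2 * C ^ 2) := by
        rw [integral_add hi2 (integrable_const _), integral_add hi1 (hρDi.const_mul _),
          integral_add (hDsqi.const_mul _) (hEi.const_mul _),
          integral_const_mul, integral_const_mul, integral_const_mul, hE0, hD0, integral_nu_const]
        ring
      rw [h1] at hR
      linarith
    · filter_upwards [ae_mem_nu] with x hx hx0
      have h1 : (-(ρ x * D x)) ^ 2 / h x ≤ C ^ 2 := by
        rw [div_le_iff₀ hx0, ← sq_abs]
        have h2 : σ x ≤ h x := min_le_left _ _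
        have h3 : σ x ≤ 1 := min_le_right _ _
        calc |-(ρ x * D x)| ^ 2 ≤ (C * σ x) ^ 2 := by gcongr; exact hφσ x hx
          _ = C ^ 2 * (σ x * σ x) := by ring
          _ ≤ C ^ 2 * (1 * h x) := by
            gcongr
          _ = _ := by ring
      have h2 := mul_le_mul_of_nonneg_left h1 (sq_nonneg t)
      have h3 : t * (-(ρ x * D x) * v x) = (-t) * (ρ x * D x ^ 2) + (-t) * E x := by
        simp only [hE, hD]; ring
      change t * (-(ρ x * D x) * v x) + _ + _ ≤ _
      linarith
    · filter_upwards with x hx0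
      have : ρ x = 0 := by simp [hρ, hσ, hx0]
      simp only [this, hE]
      nlinarith [mul_nonneg (sq_nonneg t) (sq_nonneg C)]
  have h0 : 0 ≤ᵐ[nu] fun x => ρ x * D x ^ 2 := by
    filter_upwards [ae_mem_nu] with x hx using mul_nonneg (hρ0 x hx) (sq_nonneg _)
  have hz := (integral_eq_zero_iff_of_nonneg_ae h0 hDsqi).1
    (le_antisymm hle (integral_nonneg_of_ae h0))
  filter_upwards [hz, ae_mem_nu] with x hx hxI hx0
  have hρx : ρ x ≠ 0 := (div_pos (lt_min hx0 zero_lt_one) (by positivity)).ne'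
  have hDx : D x = 0 := by simpa [hρx] using hx
  have hw := ha.weight_pos x hxI hx0
  have : v x = α + β * P2 x := sub_eq_zero.1 hDx
  rw [← this, hv, Real.exp_log (div_pos hx0 hw)]
  field_simp

/-- A local minimiser charges the whole set where the weight is positive: placing a mass of
order `t` where `h = 0` changes the energy by a multiple of `t log t < 0`, which dominates the
linear terms. -/
theorem IsFreeLocalMin.ae_pos {η : ℝ} {h : ℝ → ℝ} (hm : IsFreeLocalMin η h) {α β : ℝ}
    (hexp : ∀ᵐ x ∂nu, 0 < h x → h x = weight η (order h) x * Real.exp (α + β * P2 x)) :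
    ∀ᵐ x ∂nu, 0 < weight η (order h) x → 0 < h x := by
  have ha := hm.admissible
  have hhm := ha.measurable
  set w : ℝ → ℝ := weight η (order h) with hw
  set σ : ℝ → ℝ := fun x => min (h x) 1 with hσ
  have hσm : Measurable σ := by fun_prop
  have hσ0 : ∀ x ∈ Icc (-1 : ℝ) 1, 0 ≤ σ x := fun x hx => le_min (ha.nonneg x hx) zero_le_one
  have hσ1 : ∀ x, σ x ≤ 1 := fun x => min_le_right _ _
  have hσh : ∀ x, σ x ≤ h x := fun x => min_le_left _ _
  have hσi : Integrable σ nu := integrable_nu_of_bound hσm 1 fun x hx => by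
    rw [abs_of_nonneg (hσ0 x hx)]; exact hσ1 x
  have hσpos : 0 < ∫ x, σ x ∂nu :=
    ha.integral_pos_of_pos (fun x hx => lt_min hx zero_lt_one) hσ0 hσi
  set q : ℝ → ℝ := {x | h x = 0}.indicator (fun x => max (w x) 0) with hq
  have hqm : Measurable q :=
    Measurable.indicator (by fun_prop) (hhm (measurableSet_singleton 0))
  have hq0 : ∀ x, 0 ≤ q x := fun x => indicator_nonneg (fun x _ => le_max_right _ _) x
  set W : ℝ := 2 / 3 * |order h| + |η| with hW
  have hwW : ∀ x ∈ Icc (-1 : ℝ) 1, |w x| ≤ W := fun x hx => by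
    simp only [hw, weight, hW]
    refine (abs_sub _ _).trans ?_
    rw [abs_mul, abs_mul, abs_of_pos (by norm_num : (0 : ℝ) < 2 / 3)]
    have := abs_P2_le hx
    have := mul_le_mul_of_nonneg_left this (by positivity : 0 ≤ 2 / 3 * |order h|)
    linarith
  have hW0 : 0 ≤ W := by positivity
  have hqW : ∀ x ∈ Icc (-1 : ℝ) 1, q x ≤ W := fun x hx => by
    refine indicator_apply_le' (fun _ => max_le ((le_abs_self _).trans (hwW x hx)) hW0)
      (fun _ => hW0)
  have hqi : Integrable q nu := integrable_nu_of_bound hqm W fun x hx => by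
    rw [abs_of_nonneg (hq0 x)]; exact hqW x hx
  have hqh : ∀ x, 0 < h x → q x = 0 := fun x hx =>
    indicator_of_notMem (fun h0 => hx.ne' h0) _
  obtain ⟨_, _, hdual⟩ := exists_dual hσ0 hσi hσpos
  obtain ⟨a, b, -, -, hr1, hr2⟩ := hdual (∫ x, q x ∂nu) (∫ x, P2 x * q x ∂nu)
  have hσP : Integrable (fun x => σ x * (a + b * P2 x)) nu := by
    have := integrable_continuous_mul_nu hσi (g := fun x => a + b * P2 x) (by fun_prop)
    simpa [mul_comm] using this
  set φ : ℝ → ℝ := fun x => q x - σ x * (a + b * P2 x) with hφ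
  have hφm : Measurable φ := by fun_prop
  set C : ℝ := |a| + |b| with hC
  have hC0 : 0 ≤ C := by positivity
  have hab : ∀ x ∈ Icc (-1 : ℝ) 1, |σ x * (a + b * P2 x)| ≤ C * σ x := fun x hx => by
    rw [abs_mul, abs_of_nonneg (hσ0 x hx), mul_comm]
    refine mul_le_mul_of_nonneg_right ?_ (hσ0 x hx)
    refine (abs_add_le _ _).trans ?_
    rw [abs_mul]
    nlinarith [abs_P2_le hx, abs_nonneg b]
  have hφh : ∀ x ∈ Icc (-1 : ℝ) 1, 0 < h x → |φ x| ≤ C * σ x := fun x hx hx0 => by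
    simp only [hφ, hqh x hx0, zero_sub, abs_neg]; exact hab x hx
  have hφz : ∀ x, h x = 0 → φ x = q x := fun x hx0 => by simp [hφ, hσ, hx0]
  obtain ⟨t₀, ht₀, hvar⟩ := hm.le_of_perturbation (φ := φ) (M := W + C) hφm
    (fun x hx => by
      refine (abs_sub _ _).trans (add_le_add ?_ ?_)
      · rw [abs_of_nonneg (hq0 x)]; exact hqW x hx
      · exact (hab x hx).trans (by nlinarith [hσ1 x]))
    (by simp only [hφ]; rw [integral_sub hqi hσP, hr1, sub_self])
    (by
      simp only [hφ, mul_sub]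
      rw [integral_sub (integrable_continuous_mul_nu hqi continuous_P2)
        (integrable_continuous_mul_nu hσP continuous_P2), hr2, sub_self])
    (fun x hx hx0 => (hφh x hx hx0).trans (by
      have := hσh x
      nlinarith [hσ0 x hx]))
    (fun x hx hx0 => by
      rw [hφz x hx0]
      refine ⟨hq0 x, fun hqx => ?_⟩
      have h1 : q x = max (w x) 0 := indicator_of_mem (s := {x | h x = 0}) hx0 _
      rw [h1] at hqx ⊢
      rcases lt_max_iff.1 hqx with h | h
      · exact max_eq_left h.le
      · exact absurd h (lt_irrefl _))
  set K : ℝ := C * (|α| + |β|) + C + C ^ 2 with hK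
  have hK0 : 0 ≤ K := by positivity
  have hq_int : ∫ x, q x ∂nu ≤ 0 := by
    by_contra hc
    push Not at hc
    set c := ∫ x, q x ∂nu with hcdef
    have key : ∀ t, 0 < t → t ≤ min t₀ 1 → -(2 * K) ≤ Real.log t * c := by
      intro t ht htle
      have ht1 : t ≤ 1 := htle.trans (min_le_right _ _)
      have hR := hvar t ht (htle.trans (min_le_left _ _)) (fun x => t * K + t * Real.log t * q x)
        ((integrable_const _).add (hqi.const_mul _)) ?_ ?_
      · rw [integral_add (integrable_const _) (hqi.const_mul _), integral_nu_const,
          integral_const_mul, ← hcdef] at hR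
        have : 0 ≤ t * (2 * K + Real.log t * c) := by linarith
        linarith [nonneg_of_mul_nonneg_right this ht]
      · filter_upwards [ae_mem_nu, hexp] with x hx hx1 hx0
        have hwx := ha.weight_pos x hx hx0
        have hlog : Real.log (h x / w x) = α + β * P2 x := by
          have : h x / w x = Real.exp (α + β * P2 x) := by
            rw [div_eq_iff hwx.ne', hx1 hx0, mul_comm]
          rw [this, Real.log_exp]
        change t * (φ x * Real.log (h x / w x)) + _ + _ ≤ _
        rw [hlog, hqh x hx0, mul_zero, add_zero]
        have h1 : |α + β * P2 x| ≤ |α| + |β| := by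
          refine (abs_add_le _ _).trans ?_
          rw [abs_mul]
          nlinarith [abs_P2_le hx, abs_nonneg β]
        have h2 : |φ x| ≤ C := (hφh x hx hx0).trans (by nlinarith [hσ1 x])
        have h3 : φ x * (α + β * P2 x) ≤ C * (|α| + |β|) := by
          refine (le_abs_self _).trans ?_
          rw [abs_mul]; gcongr
        have h4 : φ x ^ 2 / h x ≤ C ^ 2 := by
          rw [div_le_iff₀ hx0, ← sq_abs]
          calc |φ x| ^ 2 ≤ (C * σ x) ^ 2 := by gcongr; exact hφh x hx hx0
            _ = C ^ 2 * (σ x * σ x) := by ring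
            _ ≤ C ^ 2 * (1 * h x) := by
              gcongr
              · exact hσ1 x
              · exact hσh x
            _ = _ := by ring
        have h5 : t ^ 2 * (φ x ^ 2 / h x) ≤ t * C ^ 2 := by
          have : t ^ 2 ≤ t := by nlinarith
          exact mul_le_mul this h4 (div_nonneg (sq_nonneg _) hx0.le) ht.le
        have h6 := mul_le_mul_of_nonneg_left h3 ht.le
        have h7 := mul_le_mul_of_nonneg_left ((le_abs_self _).trans h2) ht.le
        simp only [hK]; linarith
      · filter_upwards with x hx0
        rw [hφz x hx0]
        have : 0 ≤ t * K := by positivity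
        linarith
    set s := min (min t₀ 1) (Real.exp (-(2 * K + 1) / c)) with hs
    have hs0 : 0 < s := lt_min (lt_min ht₀ one_pos) (Real.exp_pos _)
    have h1 := key s hs0 (min_le_left _ _)
    have h2 : Real.log s ≤ -(2 * K + 1) / c := by
      rw [← Real.log_exp (-(2 * K + 1) / c)]
      exact Real.log_le_log hs0 (min_le_right _ _)
    have h3 : Real.log s * c ≤ -(2 * K + 1) := by
      rwa [le_div_iff₀ hc] at h2
    linarith
  have h0 : 0 ≤ᵐ[nu] q := ae_of_all _ hq0
  have hz := (integral_eq_zero_iff_of_nonneg_ae h0 hqi).1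
    (le_antisymm hq_int (integral_nonneg_of_ae h0))
  filter_upwards [hz, ae_mem_nu] with x hx hxI hwx
  refine lt_of_le_of_ne (ha.nonneg x hxI) fun h1 => ?_
  have h2 : q x = max (w x) 0 := indicator_of_mem (s := {x | h x = 0}) h1.symm _
  rw [h2, max_eq_left hwx.le] at hx
  exact hwx.ne' hx

/-- The mass of the densities `exp (α + β P₂) max (w, 0)` is differentiable in the order parameter
on which the weight `w` depends: the zero set of `w` is null. -/
theorem hasDerivAt_integral_exp_mul_weight {η S : ℝ} (α β : ℝ)
    (hne : ∀ᵐ x ∂nu, weight η S x ≠ 0) :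
    HasDerivAt (fun t => ∫ x, Real.exp (α + β * P2 x) * max (weight η (S + t) x) 0 ∂nu)
      (∫ x, Real.exp (α + β * P2 x) * (if 0 < weight η S x then 2 / 3 * P2 x else 0) ∂nu) 0 := by
  have hwt : ∀ t x, weight η (S + t) x = weight η S x + t * (2 / 3 * P2 x) := fun t x => by
    unfold weight; ring
  have hc : ∀ t, Continuous fun x => Real.exp (α + β * P2 x) * max (weight η (S + t) x) 0 :=
    fun t => by fun_prop
  refine (hasDerivAt_integral_of_dominated_loc_of_lip (s := univ)
    (bound := fun x => Real.exp (α + β * P2 x) * |2 / 3 * P2 x|) Filter.univ_mem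
    (Filter.Eventually.of_forall fun t => (hc t).aestronglyMeasurable)
    (integrable_nu_of_continuous (hc 0)) ?_ ?_ (integrable_nu_of_continuous (by fun_prop)) ?_).2
  · apply Measurable.aestronglyMeasurable
    exact Measurable.mul (by fun_prop) (Measurable.ite
      (measurableSet_lt measurable_const (by fun_prop)) (by fun_prop) measurable_const)
  · filter_upwards with x
    refine LipschitzWith.lipschitzOnWith (LipschitzWith.of_dist_le_mul fun s t => ?_)
    have he := Real.exp_pos (α + β * P2 x)
    rw [Real.dist_eq, Real.dist_eq, ← mul_sub, Real.coe_nnabs,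
      abs_of_nonneg (mul_nonneg he.le (abs_nonneg _)), abs_mul (Real.exp _) (_ - _),
      abs_of_pos he, mul_assoc]
    refine mul_le_mul_of_nonneg_left ?_ he.le
    refine (abs_max_sub_max_le_abs _ _ _).trans ?_
    rw [hwt, hwt, ← abs_mul]
    apply le_of_eq
    congr 1; ring
  · filter_upwards [hne] with x hx
    refine HasDerivAt.const_mul _ ?_
    have hd : HasDerivAt (fun t => weight η (S + t) x) (2 / 3 * P2 x) 0 := by
      simp_rw [hwt]
      simpa using ((hasDerivAt_id (0 : ℝ)).mul_const (2 / 3 * P2 x)).const_add (weight η S x)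
    have h0 : weight η (S + 0) x = weight η S x := by rw [add_zero]
    rcases hx.lt_or_gt with hx | hx
    · rw [if_neg (not_lt.2 hx.le)]
      refine (hasDerivAt_const (0 : ℝ) (0 : ℝ)).congr_of_eventuallyEq ?_
      have := hd.continuousAt.eventually_lt continuousAt_const (by rw [h0]; exact hx)
      filter_upwards [this] with t ht using max_eq_right ht.le
    · rw [if_pos hx]
      refine hd.congr_of_eventuallyEq ?_
      have := continuousAt_const.eventually_lt hd.continuousAt (by rw [h0]; exact hx)
      filter_upwards [this] with t ht using max_eq_left ht.le

theorem eq_of_forall_le_quadratic {G : ℝ → ℝ} {g β K t₀ : ℝ} (hG : HasDerivAt G g 0)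
    (ht₀ : 0 < t₀) (h : ∀ t, |t| ≤ t₀ → 0 ≤ β * t - (G t - G 0) + K * t ^ 2) : β = g := by
  have hF : HasDerivAt (fun t => β * t - (G t - G 0) + K * t ^ 2) (β * 1 - g + 0) 0 := by
    refine (((hasDerivAt_id (0 : ℝ)).const_mul β).sub (hG.sub_const (G 0))).add ?_
    simpa using (hasDerivAt_pow 2 (0 : ℝ)).const_mul K
  have hloc : IsLocalMin (fun t => β * t - (G t - G 0) + K * t ^ 2) 0 := by
    filter_upwards [Metric.ball_mem_nhds (0 : ℝ) ht₀] with t ht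
    rw [Metric.mem_ball, Real.dist_eq, sub_zero] at ht
    simpa using h t ht.le
  linarith [hloc.hasDerivAt_eq_zero hF]

theorem ae_weight_ne_zero {η S x₀ : ℝ} (hx₀ : weight η S x₀ ≠ 0) :
    ∀ᵐ x ∂nu, weight η S x ≠ 0 := by
  by_cases hS : S = 0
  · refine ae_of_all _ fun x => ?_
    simpa [weight, hS] using hx₀
  · filter_upwards [ae_P2_ne (η / (2 / 3 * S))] with x hx h0
    apply hx
    rw [eq_div_iff (by positivity)]
    unfold weight at h0; linarith

set_option maxHeartbeats 800000 in
/-- Variations of the order parameter. The competitor with order parameter `S + t` is the density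
`u = exp (α + β P₂) max (w, 0)` for the weight `w` of order parameter `S + t`, which vanishes
outside the region allowed for it, corrected by a term of size `O(t)`, supported where the original
weight is bounded below, that restores mass and order parameter. To first order its energy exceeds
that of `h` by `β t` minus the change in the mass of `u`. -/
theorem IsFreeLocalMin.multiplier_eq {η : ℝ} {h : ℝ → ℝ} (hm : IsFreeLocalMin η h) {α β : ℝ}
    (hexp : ∀ᵐ x ∂nu, h x = Real.exp (α + β * P2 x) * max (weight η (order h) x) 0) :
    β = ∫ x, Real.exp (α + β * P2 x) *
      (if 0 < weight η (order h) x then 2 / 3 * P2 x else 0) ∂nu := by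
  obtain ⟨ha, ε, hε, hmin⟩ := hm
  set S := order h with hS
  set c : ℝ → ℝ := fun x => Real.exp (α + β * P2 x) with hc
  have hcc : Continuous c := by fun_prop
  have hc0 : ∀ x, 0 < c x := fun x => Real.exp_pos _
  set A : ℝ := |α| + |β| with hA
  have hAx : ∀ x ∈ Icc (-1 : ℝ) 1, |α + β * P2 x| ≤ A := fun x hx => by
    refine (abs_add_le _ _).trans ?_
    rw [abs_mul]
    nlinarith [abs_P2_le hx, abs_nonneg β]
  set M : ℝ := Real.exp A with hM
  set m : ℝ := Real.exp (-A) with hmdef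
  have hM0 : 0 < M := Real.exp_pos _
  have hm0 : 0 < m := Real.exp_pos _
  have hcM : ∀ x ∈ Icc (-1 : ℝ) 1, c x ≤ M := fun x hx =>
    Real.exp_le_exp.2 ((le_abs_self _).trans (hAx x hx))
  have hcm : ∀ x ∈ Icc (-1 : ℝ) 1, m ≤ c x := fun x hx =>
    Real.exp_le_exp.2 (by linarith [neg_abs_le (α + β * P2 x), hAx x hx])
  have hwt : ∀ t x, weight η (S + t) x = weight η S x + t * (2 / 3 * P2 x) := fun t x => by
    unfold weight; ring
  have hP23 : ∀ x ∈ Icc (-1 : ℝ) 1, |2 / 3 * P2 x| ≤ 1 := fun x hx => by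
    rw [abs_mul, abs_of_pos (by norm_num : (0 : ℝ) < 2 / 3)]
    linarith [abs_P2_le hx]
  -- The unperturbed weight is bounded below by some `δ > 0` on a set of positive measure, since
  -- otherwise `h` would have mass at most `1 / 2`.
  set δ : ℝ := 1 / (4 * M) with hδ
  have hδ0 : 0 < δ := by positivity
  set ρ : ℝ → ℝ := {x | δ ≤ weight η S x}.indicator 1 with hρ
  have hKm : MeasurableSet {x | δ ≤ weight η S x} :=
    measurableSet_le measurable_const (by fun_prop)
  have hρm : Measurable ρ := measurable_one.indicator hKm
  have hρ0 : ∀ x, 0 ≤ ρ x := fun x => indicator_nonneg (fun _ _ => zero_le_one) x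
  have hρ1 : ∀ x, ρ x ≤ 1 := fun x => indicator_apply_le' (fun _ => le_rfl) (fun _ => zero_le_one)
  have hρi : Integrable ρ nu := integrable_nu_of_bound hρm 1 fun x _ => by
    rw [abs_of_nonneg (hρ0 x)]; exact hρ1 x
  have hρpos : 0 < ∫ x, ρ x ∂nu := by
    refine lt_of_le_of_ne (integral_nonneg hρ0) fun heq => ?_
    have h3 := (integral_eq_zero_iff_of_nonneg hρ0 hρi).1 heq.symm
    have h4 : ∫ x, h x ∂nu ≤ ∫ _, (1 / 4 : ℝ) ∂nu := by
      refine integral_mono_ae ha.integrable (integrable_const _) ?_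
      filter_upwards [h3, hexp, ae_mem_nu] with x hx hhx hxI
      have hlt : weight η S x < δ := by
        by_contra hge
        have : ρ x = 1 := indicator_of_mem (s := {x | δ ≤ weight η S x}) (not_lt.1 hge) _
        rw [this] at hx
        exact one_ne_zero hx
      rw [hhx]
      calc c x * max (weight η S x) 0 ≤ M * δ :=
            mul_le_mul (hcM x hxI) (max_le hlt.le hδ0.le) (le_max_right _ _) hM0.le
        _ = 1 / 4 := by rw [hδ]; field_simp
    rw [ha.integral_eq_one, integral_nu_const] at h4
    norm_num at h4
  obtain ⟨C, hC0, hdual⟩ := exists_dual (fun x _ => hρ0 x) hρi hρpos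
  set u : ℝ → ℝ → ℝ := fun t x => c x * max (weight η (S + t) x) 0 with hu
  have huc : ∀ t, Continuous (u t) := fun t => by fun_prop
  have hui : ∀ t, Integrable (u t) nu := fun t => integrable_nu_of_continuous (huc t)
  have hu0 : ∀ t x, 0 ≤ u t x := fun t x => mul_nonneg (hc0 x).le (le_max_right _ _)
  have hhu : h =ᵐ[nu] u 0 := by
    filter_upwards [hexp] with x hx
    simp only [hu, add_zero]; exact hx
  have hul : ∀ t, ∀ x ∈ Icc (-1 : ℝ) 1, |u t x - u 0 x| ≤ M * |t| := fun t x hx => by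
    simp only [hu]
    rw [← mul_sub, abs_mul, abs_of_pos (hc0 x)]
    refine mul_le_mul (hcM x hx) ?_ (abs_nonneg _) hM0.le
    refine (abs_max_sub_max_le_abs _ _ _).trans ?_
    rw [hwt, hwt, zero_mul, add_zero, add_sub_cancel_left, abs_mul]
    nlinarith [hP23 x hx, abs_nonneg t]
  have hmass0 : ∫ x, u 0 x ∂nu = 1 := by rw [← integral_congr_ae hhu, ha.integral_eq_one]
  have hord0 : ∫ x, P2 x * u 0 x ∂nu = S := by
    rw [hS, order]
    refine integral_congr_ae ?_
    filter_upwards [hhu] with x hx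
    rw [hx]
  have hdiff : ∀ t, ∀ g : ℝ → ℝ, Continuous g → (∀ x ∈ Icc (-1 : ℝ) 1, |g x| ≤ 1) →
      |∫ x, g x * u t x ∂nu - ∫ x, g x * u 0 x ∂nu| ≤ 2 * (M * |t|) := by
    intro t g hg hg1
    rw [← integral_sub (integrable_continuous_mul_nu (hui t) hg)
      (integrable_continuous_mul_nu (hui 0) hg)]
    have := norm_integral_le_of_norm_le (μ := nu) (f := fun x => g x * u t x - g x * u 0 x)
      (g := fun _ => M * |t|) (integrable_const _) (by
        filter_upwards [ae_mem_nu] with x hx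
        rw [Real.norm_eq_abs, ← mul_sub, abs_mul]
        have := hul t x hx
        have := hg1 x hx
        nlinarith [abs_nonneg (g x), abs_nonneg (u t x - u 0 x)])
    rwa [integral_nu_const, Real.norm_eq_abs] at this
  set r₁ : ℝ → ℝ := fun t => 1 - ∫ x, u t x ∂nu with hr₁
  set r₂ : ℝ → ℝ := fun t => S + t - ∫ x, P2 x * u t x ∂nu with hr₂
  have hrb : ∀ t, |r₁ t| + |r₂ t| ≤ (4 * M + 1) * |t| := fun t => by
    have h1 : |r₁ t| ≤ 2 * (M * |t|) := by
      have := hdiff t (fun _ => 1) continuous_const (fun x _ => by simp)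
      simp only [one_mul, hmass0] at this
      rwa [abs_sub_comm] at this
    have h2 : |r₂ t| ≤ |t| + 2 * (M * |t|) := by
      have := hdiff t P2 continuous_P2 (fun x hx => abs_P2_le hx)
      rw [hord0, abs_sub_comm] at this
      have h3 : r₂ t = t + (S - ∫ x, P2 x * u t x ∂nu) := by simp only [hr₂]; ring
      rw [h3]
      exact (abs_add_le _ _).trans (by linarith)
    linarith
  -- The correction `φ t` restores the mass and the order parameter; both defects are `O(t)`.
  choose a b hab using fun t => hdual (r₁ t) (r₂ t)
  set φ : ℝ → ℝ → ℝ := fun t x => ρ x * (a t + b t * P2 x) with hφ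
  set N : ℝ := 2 * (C * (4 * M + 1)) with hN
  have hN0 : 0 ≤ N := by positivity
  have hφN : ∀ t, ∀ x ∈ Icc (-1 : ℝ) 1, |φ t x| ≤ N * |t| * ρ x := fun t x hx => by
    obtain ⟨h1, h2, -, -⟩ := hab t
    have h3 := mul_le_mul_of_nonneg_left (hrb t) hC0
    simp only [hφ]
    rw [abs_mul, abs_of_nonneg (hρ0 x), mul_comm]
    refine mul_le_mul_of_nonneg_right ?_ (hρ0 x)
    refine (abs_add_le _ _).trans ?_
    rw [abs_mul]
    have h4 : |b t| * |P2 x| ≤ |b t| := by nlinarith [abs_P2_le hx, abs_nonneg (b t)]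
    simp only [hN]; linarith
  have hφm : ∀ t, Measurable (φ t) := fun t => by fun_prop
  have hφi : ∀ t, Integrable (φ t) nu := fun t => integrable_nu_of_bound (hφm t) (N * |t|)
    fun x hx => (hφN t x hx).trans (by nlinarith [hρ1 x, mul_nonneg hN0 (abs_nonneg t)])
  set d : ℝ := m * (δ / 2) with hd
  have hd0 : 0 < d := by positivity
  set k : ℝ → ℝ → ℝ := fun t x => u t x + φ t x with hk
  have hki : ∀ t, Integrable (k t) nu := fun t => (hui t).add (hφi t)
  have hkmass : ∀ t, ∫ x, k t x ∂nu = 1 := fun t => by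
    simp only [hk]
    rw [integral_add (hui t) (hφi t), (hab t).2.2.1]; simp only [hr₁]; ring
  have hkord : ∀ t, order (k t) = S + t := fun t => by
    simp only [order, hk, mul_add]
    rw [integral_add (integrable_continuous_mul_nu (hui t) continuous_P2)
      (integrable_continuous_mul_nu (hφi t) continuous_P2), (hab t).2.2.2]; simp only [hr₂]; ring
  have hfree_h : free η h = α + β * S := by
    have h1 : free η h = ∫ x, (α * h x + β * (P2 x * h x)) ∂nu := by
      refine integral_congr_ae ?_
      filter_upwards [hexp] with x hx
      change h x * Real.log (h x / weight η S x) = _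
      by_cases hw : 0 < weight η S x
      · have : h x / weight η S x = c x := by
          rw [hx, max_eq_left hw.le, mul_div_cancel_right₀ _ hw.ne']
        rw [this, hc, Real.log_exp]; ring
      · have : h x = 0 := by rw [hx, max_eq_right (not_lt.1 hw), mul_zero]
        simp [this]
    rw [h1, integral_add (ha.integrable.const_mul _)
      ((integrable_continuous_mul_nu ha.integrable continuous_P2).const_mul _), integral_const_mul,
      integral_const_mul, ha.integral_eq_one, hS, order]; ring
  set G : ℝ → ℝ := fun t => ∫ x, u t x ∂nu with hG
  set t₀ : ℝ := min (min (δ / 2) (d / (2 * (N + 1)))) (ε / (M + N)) with ht₀def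
  have ht₀ : 0 < t₀ := by
    refine lt_min (lt_min (by positivity) (by positivity)) (by positivity)
  have key : ∀ t, |t| ≤ t₀ → 0 ≤ β * t - (G t - 1) + 2 * (N ^ 2 / d) * t ^ 2 := by
    intro t ht
    have ht1 : |t| ≤ δ / 2 := ht.trans ((min_le_left _ _).trans (min_le_left _ _))
    have ht2 : N * |t| ≤ d / 2 := by
      have := ht.trans ((min_le_left _ _).trans (min_le_right _ _))
      rw [le_div_iff₀ (by positivity)] at this
      nlinarith [abs_nonneg t]
    have ht3 : (M + N) * |t| ≤ ε := by
      have := ht.trans (min_le_right _ _)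
      rw [le_div_iff₀ (by positivity)] at this
      linarith
    have hcases : ∀ x ∈ Icc (-1 : ℝ) 1,
        (0 < weight η (S + t) x ∧ d ≤ u t x ∧ |φ t x| ≤ N * |t|) ∨ φ t x = 0 := by
      intro x hx
      by_cases hxK : δ ≤ weight η S x
      · left
        have h1 : δ / 2 ≤ weight η (S + t) x := by
          rw [hwt]
          have h2 : |t * (2 / 3 * P2 x)| ≤ |t| := by
            rw [abs_mul]; nlinarith [hP23 x hx, abs_nonneg t]
          linarith [neg_abs_le (t * (2 / 3 * P2 x))]
        refine ⟨by linarith, ?_, ?_⟩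
        · simp only [hu, hd]
          exact mul_le_mul (hcm x hx) (h1.trans (le_max_left _ _)) (by positivity) (hc0 x).le
        · exact (hφN t x hx).trans (by nlinarith [hρ1 x, mul_nonneg hN0 (abs_nonneg t)])
      · right
        have : ρ x = 0 := indicator_of_notMem (s := {x | δ ≤ weight η S x}) hxK _
        simp [hφ, this]
    have hulog : ∀ x, 0 < weight η (S + t) x →
        0 < u t x ∧ Real.log (u t x / weight η (S + t) x) = α + β * P2 x := fun x hx => by
      have h1 : u t x = c x * weight η (S + t) x := by simp only [hu]; rw [max_eq_left hx.le]
      refine ⟨by rw [h1]; exact mul_pos (hc0 x) hx, ?_⟩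
      rw [h1, mul_div_cancel_right₀ _ hx.ne', hc, Real.log_exp]
    have huz : ∀ x, ¬ 0 < weight η (S + t) x → u t x = 0 := fun x hx => by
      simp only [hu]; rw [max_eq_right (not_lt.1 hx), mul_zero]
    have hhalf : ∀ x ∈ Icc (-1 : ℝ) 1, |φ t x| ≤ u t x / 2 := fun x hx => by
      rcases hcases x hx with ⟨-, h2, h3⟩ | h0
      · linarith
      · rw [h0, abs_zero]; linarith [hu0 t x]
    have hkz : ∀ x ∈ Icc (-1 : ℝ) 1, ¬ 0 < weight η (S + t) x → k t x = 0 := fun x hx hw => by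
      have h1 := hhalf x hx
      rw [huz x hw, zero_div] at h1
      have h2 : φ t x = 0 := abs_eq_zero.1 (le_antisymm h1 (abs_nonneg _))
      simp [hk, huz x hw, h2]
    have hkint : Integrable (fun x => k t x * Real.log (k t x / weight η (S + t) x)) nu := by
      have hkm : Measurable (k t) := (huc t).measurable.add (hφm t)
      refine Integrable.mono' (g := fun x => 3 / 2 * (A * u t x) + 3 / 2 * u t x)
        (((hui t).const_mul _).const_mul _ |>.add ((hui t).const_mul _)) (by fun_prop) ?_
      filter_upwards [ae_mem_nu] with x hx
      rw [Real.norm_eq_abs]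
      by_cases hw : 0 < weight η (S + t) x
      · obtain ⟨h1, h2⟩ := hulog x hw
        refine (abs_mul_log_div_add_le h1 hw (hhalf x hx)).trans ?_
        rw [h2, abs_mul, abs_of_pos h1]
        have := mul_le_mul_of_nonneg_left (hAx x hx) h1.le
        linarith
      · rw [hkz x hx hw, zero_mul, abs_zero]
        have := hu0 t x
        positivity
    have hadm : Admissible η (k t) := by
      refine ⟨(huc t).measurable.add (hφm t), fun x hx => ?_, hki t, hkmass t, fun x hx hkx => ?_,
        by rw [hkord]; exact hkint⟩
      · simp only [hk]
        linarith [hhalf x hx, neg_abs_le (φ t x), hu0 t x]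
      · rw [hkord]
        by_contra hw
        exact hkx.ne' (hkz x hx hw)
    have hle := hmin (k t) hadm (by
      filter_upwards [ae_mem_nu, hhu] with x hx hhx
      rw [hhx]
      have h1 : k t x - u 0 x = (u t x - u 0 x) + φ t x := by simp only [hk]; ring
      rw [h1]
      refine (abs_add_le _ _).trans ?_
      have h2 := hul t x hx
      have h3 := hφN t x hx
      have h4 : N * |t| * ρ x ≤ N * |t| := by
        nlinarith [hρ1 x, mul_nonneg hN0 (abs_nonneg t)]
      linarith)
    have hPk := integrable_continuous_mul_nu (hki t) continuous_P2
    have hi1 : Integrable (fun x => α * k t x + β * (P2 x * k t x)) nu :=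
      ((hki t).const_mul _).add (hPk.const_mul _)
    have hi2 : Integrable (fun x => α * k t x + β * (P2 x * k t x) + φ t x) nu := hi1.add (hφi t)
    have hup : free η (k t) ≤
        ∫ x, (α * k t x + β * (P2 x * k t x) + φ t x + N ^ 2 / d * t ^ 2) ∂nu := by
      rw [free, hkord]
      refine integral_mono_ae hkint (hi2.add (integrable_const _)) ?_
      filter_upwards [ae_mem_nu] with x hx
      have hr0 : 0 ≤ N ^ 2 / d * t ^ 2 := by positivity
      by_cases hw : 0 < weight η (S + t) x
      · obtain ⟨h1, h2⟩ := hulog x hw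
        have h3 := mul_log_div_add_le h1 hw (hhalf x hx)
        rw [h2] at h3
        have h4 : φ t x ^ 2 / u t x ≤ N ^ 2 / d * t ^ 2 := by
          rcases hcases x hx with ⟨-, h5, h6⟩ | h0
          · rw [div_mul_eq_mul_div]
            refine div_le_div₀ (by positivity) ?_ hd0 h5
            rw [← sq_abs, ← sq_abs t, ← mul_pow]
            gcongr
          · rw [h0]; simpa using hr0
        simp only [hk] at h3 ⊢
        linarith
      · rw [hkz x hx hw]
        have h1 := hhalf x hx
        rw [huz x hw, zero_div] at h1
        have h2 : φ t x = 0 := abs_eq_zero.1 (le_antisymm h1 (abs_nonneg _))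
        rw [h2]
        simpa using hr0
    rw [integral_add hi2 (integrable_const _), integral_add hi1 (hφi t),
      integral_add ((hki t).const_mul _) (hPk.const_mul _), integral_const_mul,
      integral_const_mul, integral_nu_const, hkmass, (hab t).2.2.1] at hup
    have h6 : ∫ x, P2 x * k t x ∂nu = S + t := hkord t
    rw [h6] at hup
    rw [hfree_h] at hle
    simp only [hr₁] at hup
    simp only [hG]
    linarith
  have hx₀ : ∃ x, weight η S x ≠ 0 := by
    by_contra hall
    push Not at hall
    have : ∫ x, h x ∂nu = ∫ x, 0 ∂nu := by
      refine integral_congr_ae ?_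
      filter_upwards [hexp] with x hx
      rw [hx, hall x]; simp
    rw [ha.integral_eq_one] at this
    simp at this
  obtain ⟨x₀, hx₀⟩ := hx₀
  have hGd := hasDerivAt_integral_exp_mul_weight (η := η) (S := S) α β (ae_weight_ne_zero hx₀)
  refine eq_of_forall_le_quadratic hGd ht₀ (K := 2 * (N ^ 2 / d)) fun t ht => ?_
  have hG0 : ∫ x, Real.exp (α + β * P2 x) * max (weight η (S + 0) x) 0 ∂nu = 1 := hmass0
  rw [hG0]
  exact key t ht

/-- A local minimiser of the uniaxial free energy has the Euler-Lagrange form. -/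
theorem IsFreeLocalMin.exists_eulerLagrange {η : ℝ} {h : ℝ → ℝ} (hm : IsFreeLocalMin η h) :
    ∃ α β : ℝ, (∀ᵐ x ∂nu, h x = Real.exp (α + β * P2 x) * max (weight η (order h) x) 0) ∧
      β = ∫ x, Real.exp (α + β * P2 x) *
        (if 0 < weight η (order h) x then 2 / 3 * P2 x else 0) ∂nu := by
  obtain ⟨α, β, hexp⟩ := hm.exists_exp
  have hae : ∀ᵐ x ∂nu, h x = Real.exp (α + β * P2 x) * max (weight η (order h) x) 0 := by
    filter_upwards [hexp, hm.ae_pos hexp, ae_mem_nu] with x h1 h2 hx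
    by_cases hw : 0 < weight η (order h) x
    · rw [max_eq_left hw.le, mul_comm]; exact h1 (h2 hw)
    · rw [max_eq_right (not_lt.1 hw), mul_zero]
      by_contra hne
      exact hw (hm.admissible.weight_pos x hx
        (lt_of_le_of_ne (hm.admissible.nonneg x hx) (Ne.symm hne)))
  exact ⟨α, β, hae, hm.multiplier_eq hae⟩

/-! ### The energy of axially symmetric densities -/

theorem integral_kernel_axial {h : ℝ → ℝ} (hi : Integrable h nu) (e p : S2) :
    ∫ q, ((dot p q) ^ 2 - 1 / 3) * axial h e q ∂surf = 2 / 3 * order h * P2 (dot p e) := by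
  have h1 := integral_dot_mul_traceless (hi.const_mul (2 * Real.pi)⁻¹) e
    (p : EuclideanSpace ℝ (Fin 3)) p
  have h2 : inner ℝ (p : EuclideanSpace ℝ (Fin 3)) p = (1 : ℝ) := dot_self p
  rw [h2] at h1
  have h3 : ∫ q, ((dot p q) ^ 2 - 1 / 3) * axial h e q ∂surf = ∫ q : S2, (2 * Real.pi)⁻¹ *
      h (dot q e) * (inner ℝ (q : EuclideanSpace ℝ (Fin 3)) p *
        inner ℝ (q : EuclideanSpace ℝ (Fin 3)) p - 1 / 3) ∂surf := by
    refine integral_congr_ae (ae_of_all _ fun q => ?_)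
    have : inner ℝ (q : EuclideanSpace ℝ (Fin 3)) p = dot p q := dot_comm q p
    simp only [this, axial]; ring
  have h4 : inner ℝ (e : EuclideanSpace ℝ (Fin 3)) p = dot p e := dot_comm e p
  have h5 : ∫ x, P2 x * ((2 * Real.pi)⁻¹ * h x) ∂nu = (2 * Real.pi)⁻¹ * order h := by
    rw [order, ← integral_const_mul]
    congr 1; ext x; ring
  rw [h3, h1, h4, h5]
  have := Real.pi_pos
  unfold P2
  field_simp

theorem energyDensity_axial (η : ℝ) {h : ℝ → ℝ} (hi : Integrable h nu) (e p : S2) :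
    energyDensity η (axial h e) p = ((axial h e p * Real.log (axial h e p) : ℝ) : EReal)
      + (axial h e p : EReal) * negLog (weight η (order h) (dot p e)) := by
  rw [energyDensity, integral_kernel_axial hi]; rfl

theorem energy_congr {η : ℝ} {f g : S2 → ℝ} (h : f =ᵐ[surf] g) : energy η f = energy η g := by
  have hd : energyDensity η f =ᵐ[surf] energyDensity η g := by
    filter_upwards [h] with p hp
    have : ∫ q, ((dot p q) ^ 2 - 1 / 3) * f q ∂surf = ∫ q, ((dot p q) ^ 2 - 1 / 3) * g q ∂surf := by
      refine integral_congr_ae ?_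
      filter_upwards [h] with q hq
      rw [hq]
    rw [energyDensity, energyDensity, this, hp]
  unfold energy
  congr 2
  · refine lintegral_congr_ae ?_
    filter_upwards [hd] with p hp
    rw [hp]
  · refine lintegral_congr_ae ?_
    filter_upwards [hd] with p hp
    rw [hp]

/-- The real energy density on the sphere in terms of the variable `x = p · e`. -/
noncomputable def axialDensity (η : ℝ) (h : ℝ → ℝ) (x : ℝ) : ℝ :=
  (2 * Real.pi)⁻¹ * (h x * Real.log (h x / weight η (order h) x) - Real.log (2 * Real.pi) * h x)

theorem energyDensity_eq_coe {η : ℝ} {h : ℝ → ℝ} (hi : Integrable h nu)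
    (h0 : ∀ x ∈ Icc (-1 : ℝ) 1, 0 ≤ h x)
    (hw : ∀ x ∈ Icc (-1 : ℝ) 1, 0 < h x → 0 < weight η (order h) x) (e p : S2) :
    energyDensity η (axial h e) p = (axialDensity η h (dot p e) : EReal) := by
  rw [energyDensity_axial η hi, axialDensity]
  have hx := dot_mem_Icc p e
  simp only [axial]
  set x := dot p e
  rcases (h0 x hx).lt_or_eq with hp | hz
  · have hwx := hw x hx hp
    rw [negLog, if_pos hwx, ← EReal.coe_mul, ← EReal.coe_add, EReal.coe_eq_coe_iff,
      Real.log_mul (by positivity) hp.ne', Real.log_inv, Real.log_div hp.ne' hwx.ne']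
    ring
  · simp [← hz]

theorem energy_eq_coe {η : ℝ} {f : S2 → ℝ} {G : S2 → ℝ} (hG : Integrable G surf)
    (hf : ∀ p, energyDensity η f p = (G p : EReal)) :
    energy η f = ((∫ p, G p ∂surf : ℝ) : EReal) := by
  have h1 := integral_eq_lintegral_pos_part_sub_lintegral_neg_part hG
  have hP : ∫⁻ p, ENNReal.ofReal (G p) ∂surf ≠ ⊤ := hG.lintegral_lt_top.ne
  have hN : ∫⁻ p, ENNReal.ofReal (-G p) ∂surf ≠ ⊤ := hG.neg.lintegral_lt_top.ne
  rw [energy, h1, EReal.coe_sub, EReal.coe_ennreal_toReal hP, EReal.coe_ennreal_toReal hN]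
  simp_rw [hf, ← EReal.coe_neg, EReal.toENNReal_of_ne_top (EReal.coe_ne_top _), EReal.toReal_coe]

theorem Admissible.integrable_axialDensity {η : ℝ} {h : ℝ → ℝ} (ha : Admissible η h) :
    Integrable (axialDensity η h) nu :=
  (ha.integrable_log.sub (ha.integrable.const_mul _)).const_mul _

theorem Admissible.energy_axial {η : ℝ} {h : ℝ → ℝ} (ha : Admissible η h) (e : S2) :
    energy η (axial h e) = ((free η h - Real.log (2 * Real.pi) : ℝ) : EReal) := by
  have hi := ha.integrable_axialDensity
  rw [energy_eq_coe ((integrable_dot_iff hi.1 e).2 hi)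
    (energyDensity_eq_coe ha.integrable ha.nonneg ha.weight_pos e), integral_dot hi.1]
  congr 1
  simp only [axialDensity]
  rw [integral_const_mul, integral_sub ha.integrable_log (ha.integrable.const_mul _),
    integral_const_mul, ha.integral_eq_one, free]
  field_simp

theorem isProbDensity_axial {h : ℝ → ℝ} (hh : IsProbDensity nu h) (e : S2) :
    IsProbDensity surf (axial h e) := by
  have hi := hh.integrable.const_mul (2 * Real.pi)⁻¹
  refine ⟨(integrable_dot_iff hi.1 e).2 hi, ?_, ?_⟩
  · have := ae_dot (e := e) hh.nonneg
    filter_upwards [this] with p hp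
    exact mul_nonneg (by positivity) hp
  · have := integral_dot hi.1 e
    unfold axial
    rw [this, integral_const_mul, hh.integral_eq_one]
    field_simp

theorem Admissible.isProbDensity {η : ℝ} {h : ℝ → ℝ} (ha : Admissible η h) : IsProbDensity nu h :=
  ⟨ha.integrable, by filter_upwards [ae_mem_nu] with x hx using ha.nonneg x hx, ha.integral_eq_one⟩

theorem Admissible.isUniaxial {η : ℝ} {h : ℝ → ℝ} (ha : Admissible η h) (e : S2) :
    IsUniaxial (axial h e) :=
  ⟨isProbDensity_axial ha.isProbDensity e, fun x => (2 * Real.pi)⁻¹ * h x, e,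
    ha.measurable.const_mul _, ae_of_all _ fun _ => rfl⟩

theorem axial_congr {h k : ℝ → ℝ} (hk : h =ᵐ[nu] k) (e : S2) : axial h e =ᵐ[surf] axial k e := by
  filter_upwards [ae_dot (e := e) hk] with p hp
  rw [axial, axial, hp]

theorem order_congr {h k : ℝ → ℝ} (hk : h =ᵐ[nu] k) : order h = order k := by
  refine integral_congr_ae ?_
  filter_upwards [hk] with x hx
  rw [hx]

theorem abs_weight_le (η S : ℝ) {x : ℝ} (hx : x ∈ Icc (-1 : ℝ) 1) :
    |weight η S x| ≤ 2 / 3 * |S| + |η| := by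
  unfold weight
  refine (abs_sub _ _).trans ?_
  rw [abs_mul, abs_mul, abs_of_pos (by norm_num : (0 : ℝ) < 2 / 3)]
  have := mul_le_mul_of_nonneg_left (abs_P2_le hx) (by positivity : 0 ≤ 2 / 3 * |S|)
  linarith

/-- The negative part of the energy density is at most linear in the density, because `t log t` is
bounded below and the weight is bounded above; so its integral is finite. -/
theorem neg_energyDensity_le {η : ℝ} {h : ℝ → ℝ} (hi : Integrable h nu)
    (h0 : ∀ x, 0 ≤ h x) (e p : S2) :
    (-energyDensity η (axial h e) p).toENNReal ≤
      ENNReal.ofReal (1 + (2 / 3 * |order h| + |η|) * axial h e p) := by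
  rw [energyDensity_axial η hi]
  set W := 2 / 3 * |order h| + |η|
  have hf : 0 ≤ axial h e p := mul_nonneg (by positivity) (h0 _)
  set f := axial h e p
  have hW : weight η (order h) (dot p e) ≤ W :=
    (le_abs_self _).trans (abs_weight_le η _ (dot_mem_Icc p e))
  set w := weight η (order h) (dot p e)
  rcases hf.lt_or_eq with hf | hf
  · by_cases hw : 0 < w
    · rw [negLog, if_pos hw, ← EReal.coe_mul, ← EReal.coe_add, ← EReal.coe_neg,
        EReal.toENNReal_of_ne_top (EReal.coe_ne_top _), EReal.toReal_coe]
      refine ENNReal.ofReal_le_ofReal ?_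
      have h1 := Real.one_sub_inv_le_log_of_pos hf
      have h2 := Real.log_le_sub_one_of_pos hw
      have h3 : f * (1 - f⁻¹) ≤ f * Real.log f := by gcongr
      have h4 : f * (1 - f⁻¹) = f - 1 := by field_simp
      have h5 : f * Real.log w ≤ f * W := by gcongr; linarith
      linarith
    · rw [negLog, if_neg hw, EReal.coe_mul_top_of_pos hf, EReal.coe_add_top]
      simp
  · simp [← hf]

/-- A uniaxial density of finite energy is represented by an admissible density on `[-1, 1]`:
the negative part of the energy being finite, the positive part is finite too, which forces the
density to vanish where the weight is not positive and `h log (h / w)` to be integrable. -/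
theorem exists_admissible {η : ℝ} {f : S2 → ℝ} (hf : IsUniaxial f) (hE : energy η f < ⊤) :
    ∃ (h : ℝ → ℝ) (e : S2), Admissible η h ∧ f =ᵐ[surf] axial h e := by
  obtain ⟨hd, g, e, hg, hfg⟩ := hf
  set k : ℝ → ℝ := fun x => max (2 * Real.pi * g x) 0 with hk
  have hkm : Measurable k := by fun_prop
  have hk0 : ∀ x, 0 ≤ k x := fun x => le_max_right _ _
  have hfk : f =ᵐ[surf] axial k e := by
    filter_upwards [hfg, hd.nonneg] with p hp hp0
    rw [hp] at hp0
    rw [hp, axial, hk]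
    simp only
    rw [max_eq_left (mul_nonneg (by positivity) hp0)]
    field_simp
  have hki : Integrable k nu := by
    have h1 : Integrable (axial k e) surf := hd.integrable.congr hfk
    have h2 := (integrable_dot_iff (F := fun x => (2 * Real.pi)⁻¹ * k x)
      (hkm.const_mul _).aestronglyMeasurable e).1 h1
    refine (h2.const_mul (2 * Real.pi)).congr (ae_of_all _ fun x => ?_)
    simp only; field_simp
  rw [energy_congr hfk, energy] at hE
  set P := ∫⁻ p, (energyDensity η (axial k e) p).toENNReal ∂surf with hP
  set N := ∫⁻ p, (-energyDensity η (axial k e) p).toENNReal ∂surf with hN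
  have hNfin : N ≠ ⊤ := by
    refine ne_top_of_le_ne_top ?_ (lintegral_mono fun p => neg_energyDensity_le hki hk0 e p)
    exact ((integrable_const (1 : ℝ)).add
      ((hd.integrable.congr hfk).const_mul _)).lintegral_lt_top.ne
  have hPfin : P ≠ ⊤ := by
    intro hPt
    rw [hPt, ← EReal.coe_ennreal_toReal hNfin] at hE
    simp at hE
  -- Where the weight is not positive the energy density is infinite, hence the density vanishes.
  have hB : ∀ᵐ x ∂nu, 0 < k x → 0 < weight η (order k) x := by
    set B : Set ℝ := {x | 0 < k x → 0 < weight η (order k) x} with hBdef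
    have hBm : MeasurableSet B := by
      have : B = {x | 0 < k x}ᶜ ∪ {x | 0 < weight η (order k) x} := by
        ext x; simp only [hBdef, mem_ofPred_eq, mem_union, mem_compl_iff, imp_iff_not_or]
      rw [this]
      exact (measurableSet_lt measurable_const hkm).compl.union
        (measurableSet_lt measurable_const (by fun_prop))
    refine ae_nu_of_ae_dot (e := e) hBm ?_
    set B' : Set S2 := (fun p => dot p e) ⁻¹' Bᶜ with hB'
    have hB'm : MeasurableSet B' := measurable_dot e hBm.compl
    have h1 : ∫⁻ p, B'.indicator (fun _ => ⊤) p ∂surf ≤ P := by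
      refine lintegral_mono fun p => ?_
      refine indicator_apply_le' (fun hp => ?_) (fun _ => zero_le)
      have hp' : 0 < k (dot p e) ∧ ¬ 0 < weight η (order k) (dot p e) := by
        simpa [hB', hBdef] using hp
      have hpos : 0 < axial k e p := mul_pos (by positivity) hp'.1
      rw [energyDensity_axial η hki, negLog, if_neg hp'.2, EReal.coe_mul_top_of_pos hpos,
        EReal.coe_add_top]
      simp
    rw [lintegral_indicator_const hB'm] at h1
    have h2 : surf B' = 0 := by
      by_contra hne
      rw [ENNReal.top_mul hne] at h1
      exact hPfin (top_le_iff.1 h1)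
    rw [ae_iff]
    exact h2
  set h : ℝ → ℝ := {x | 0 < weight η (order k) x}.indicator k with hh
  have hWm : MeasurableSet {x | 0 < weight η (order k) x} :=
    measurableSet_lt measurable_const (by fun_prop)
  have hkh : k =ᵐ[nu] h := by
    filter_upwards [hB] with x hx
    by_cases hw : 0 < weight η (order k) x
    · exact (indicator_of_mem (s := {x | 0 < weight η (order k) x}) hw _).symm
    · rw [hh, indicator_of_notMem (by exact hw)]
      by_contra hne
      exact hw (hx (lt_of_le_of_ne (hk0 x) (Ne.symm hne)))
  have hord := order_congr hkh
  have hfh : f =ᵐ[surf] axial h e := hfk.trans (axial_congr hkh e)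
  have hhm : Measurable h := hkm.indicator hWm
  have hh0 : ∀ x ∈ Icc (-1 : ℝ) 1, 0 ≤ h x := fun x _ => indicator_nonneg (fun x _ => hk0 x) x
  have hhi : Integrable h nu := hki.congr hkh
  have hhw : ∀ x ∈ Icc (-1 : ℝ) 1, 0 < h x → 0 < weight η (order h) x := fun x _ hx => by
    rw [← hord]
    by_contra hw
    have : h x = 0 := indicator_of_notMem (s := {x | 0 < weight η (order k) x}) hw _
    exact hx.ne' this
  have hGm : Measurable (axialDensity η h) := by
    unfold axialDensity; fun_prop
  have hD := energyDensity_eq_coe hhi hh0 hhw e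
  have hD' : ∀ᵐ p ∂surf, energyDensity η (axial k e) p = (axialDensity η h (dot p e) : EReal) := by
    filter_upwards [axial_congr hkh e] with p hp
    rw [← hD p, energyDensity_axial η hki, energyDensity_axial η hhi, hp, hord]
  have hPE : P = ∫⁻ p, ENNReal.ofReal (axialDensity η h (dot p e)) ∂surf := by
    refine lintegral_congr_ae ?_
    filter_upwards [hD'] with p hp
    rw [hp, EReal.toENNReal_of_ne_top (EReal.coe_ne_top _), EReal.toReal_coe]
  have hNE : N = ∫⁻ p, ENNReal.ofReal (-axialDensity η h (dot p e)) ∂surf := by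
    refine lintegral_congr_ae ?_
    filter_upwards [hD'] with p hp
    rw [hp, ← EReal.coe_neg, EReal.toENNReal_of_ne_top (EReal.coe_ne_top _), EReal.toReal_coe]
  have hGi : Integrable (axialDensity η h) nu := by
    rw [← integrable_dot_iff hGm.aestronglyMeasurable e]
    have hGs : Measurable fun p => axialDensity η h (dot p e) := hGm.comp (measurable_dot e)
    refine ⟨hGs.aestronglyMeasurable, ?_⟩
    rw [hasFiniteIntegral_iff_norm]
    have h1 : ∀ p, ENNReal.ofReal ‖axialDensity η h (dot p e)‖ ≤
        ENNReal.ofReal (axialDensity η h (dot p e)) +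
          ENNReal.ofReal (-axialDensity η h (dot p e)) := fun p => by
      rw [Real.norm_eq_abs]
      rcases abs_choice (axialDensity η h (dot p e)) with h | h <;> rw [h] <;> simp
    refine (lintegral_mono h1).trans_lt ?_
    rw [lintegral_add_left hGs.ennreal_ofReal, ← hPE, ← hNE]
    exact ENNReal.add_lt_top.2 ⟨hPfin.lt_top, hNfin.lt_top⟩
  refine ⟨h, e, ⟨hhm, hh0, hhi, ?_, hhw, ?_⟩, hfh⟩
  · have h1 := integral_dot (hhi.const_mul (2 * Real.pi)⁻¹).1 e
    rw [integral_const_mul _ h, mul_inv_cancel_left₀ (by positivity)] at h1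
    exact h1.symm.trans ((integral_congr_ae hfh.symm).trans hd.integral_eq_one)
  · refine ((hGi.const_mul (2 * Real.pi)).add
      (hhi.const_mul (Real.log (2 * Real.pi)))).congr (ae_of_all _ fun x => ?_)
    simp only [axialDensity, Pi.add_apply]
    field_simp
    ring

/-- An `L^r`-local minimiser on the sphere is, in the variable `p · e`, a minimiser with respect to
uniformly small variations, since the surface measure is finite. -/
theorem IsUniaxialLocalMin.isFreeLocalMin {η : ℝ} {r : ℝ≥0∞} {f : S2 → ℝ}
    (hf : IsUniaxialLocalMin η r f) {h : ℝ → ℝ} {e : S2} (ha : Admissible η h)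
    (hfh : f =ᵐ[surf] axial h e) : IsFreeLocalMin η h := by
  obtain ⟨ε, hε, hmin⟩ := hf.le_energy
  set c : ℝ≥0∞ := surf univ ^ r.toReal⁻¹ with hc
  have hcfin : c ≠ ⊤ := ENNReal.rpow_ne_top_of_nonneg (by positivity) (measure_ne_top _ _)
  refine ⟨ha, ε / (c.toReal + 1), by positivity, fun k hk hkh => ?_⟩
  have hle := hmin (axial k e) (hk.isUniaxial e) (by
    have hb : ∀ᵐ p ∂surf, ‖(axial k e - f) p‖ ≤ ε / (c.toReal + 1) := by
      filter_upwards [hfh, ae_dot (e := e) hkh] with p h1 h2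
      rw [Pi.sub_apply, h1, axial, axial, ← mul_sub, Real.norm_eq_abs, abs_mul]
      have h3 : |(2 * Real.pi)⁻¹| ≤ 1 := by
        rw [abs_of_pos (by positivity)]
        exact inv_le_one_of_one_le₀ (by linarith [Real.pi_gt_three])
      exact (mul_le_of_le_one_left (abs_nonneg _) h3).trans h2
    refine (eLpNorm_le_of_ae_bound hb).trans_lt ?_
    rw [← hc, ← ENNReal.ofReal_toReal hcfin, ← ENNReal.ofReal_mul ENNReal.toReal_nonneg,
      ENNReal.ofReal_lt_ofReal_iff hε, ENNReal.toReal_ofReal ENNReal.toReal_nonneg,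
      mul_div_assoc', div_lt_iff₀ (by positivity)]
    nlinarith [ENNReal.toReal_nonneg (a := c)])
  rw [energy_congr hfh, ha.energy_axial e, hk.energy_axial e, EReal.coe_le_coe_iff] at hle
  linarith

/-! ### The uniaxial Euler-Lagrange equation -/

theorem intervalIntegral_eq_nu (f : ℝ → ℝ) : ∫ x in (-1 : ℝ)..1, f x = ∫ x, f x ∂nu := by
  rw [intervalIntegral.integral_of_le (by norm_num), integral_Icc_eq_integral_Ioc]

theorem IsUniaxialLocalMin.exists_uniaxialEL {η : ℝ} {r : ℝ≥0∞} {f : S2 → ℝ}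
    (hf : IsUniaxialLocalMin η r f) : ∃ (h : ℝ → ℝ) (n : S2), UniaxialEL η h ∧
      ∀ᵐ p ∂surf, f p = axial h n p := by
  obtain ⟨k, e, ha, hfk⟩ := exists_admissible hf.uniaxial hf.finite_energy
  obtain ⟨α, β, hk, hβ⟩ := (hf.isFreeLocalMin ha hfk).exists_eulerLagrange
  set h : ℝ → ℝ := fun x => (Real.exp (-α))⁻¹ * Real.exp (β * P2 x) *
    max (2 / 3 * order k * P2 x - η) 0 with hh
  have hexp : ∀ x, (Real.exp (-α))⁻¹ * Real.exp (β * P2 x) = Real.exp (α + β * P2 x) := fun x => by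
    rw [← Real.exp_neg, neg_neg, Real.exp_add]
  have hkh : k =ᵐ[nu] h := by
    filter_upwards [hk] with x hx
    rw [hx, hh]
    simp only [hexp]; rfl
  refine ⟨h, e, ⟨Real.exp (-α), order k, β, ?_, Real.exp_pos _, fun _ _ => rfl, ?_, ?_⟩,
    hfk.trans (axial_congr hkh e)⟩
  · refine ⟨ha.integrable.congr hkh, ?_, ?_⟩
    · filter_upwards with x using by positivity
    · rw [← integral_congr_ae hkh, ha.integral_eq_one]
  · rw [intervalIntegral_eq_nu]
    exact order_congr hkh
  · rw [intervalIntegral_eq_nu, ← integral_const_mul]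
    refine hβ.trans (integral_congr_ae (ae_of_all _ fun x => ?_))
    simp only [hh, hexp]
    by_cases hw : 0 < weight η (order k) x
    · rw [if_pos hw]
      have hw' : 0 < 2 / 3 * order k * P2 x - η := hw
      rw [max_eq_left hw'.le, mul_div_cancel_right₀ _ hw'.ne']
      ring
    · rw [if_neg hw]
      have hw' : ¬ 0 < 2 / 3 * order k * P2 x - η := hw
      rw [max_eq_right (not_lt.1 hw')]
      simp

/-! ### The biaxial Euler-Lagrange equation -/

theorem dot_eq_sum (p q : S2) : dot p q = ∑ i, (p : EuclideanSpace ℝ (Fin 3)) i *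
    (q : EuclideanSpace ℝ (Fin 3)) i := by
  simp [dot, PiLp.inner_apply, mul_comm]

theorem quadForm_smul_tensor (c : ℝ) (n p : S2) :
    quadForm (c • tensor n) p = 2 / 3 * c * P2 (dot p n) := by
  have h1 := dot_self p
  rw [dot_eq_sum] at h1
  rw [dot_eq_sum]
  simp only [quadForm, tensor, Matrix.smul_apply, smul_eq_mul, Fin.sum_univ_three, P2] at h1 ⊢
  simp
  linear_combination (-c / 3) * h1

theorem isSymm_smul_tensor (c : ℝ) (n : S2) : (c • tensor n).IsSymm := by
  ext i j
  simp only [Matrix.transpose_apply, Matrix.smul_apply, tensor, smul_eq_mul, eq_comm (a := j)]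
  ring

theorem trace_smul_tensor (c : ℝ) (n : S2) : (c • tensor n).trace = 0 := by
  have h1 := dot_self n
  rw [dot_eq_sum] at h1
  simp only [Matrix.trace, Matrix.diag, Matrix.smul_apply, tensor, smul_eq_mul,
    Fin.sum_univ_three] at h1 ⊢
  simp
  linear_combination c * h1

theorem moment_dot {F : ℝ → ℝ} (hF : Integrable F nu) (n : S2) :
    moment (fun p => F (dot p n)) = (2 * Real.pi * ∫ x, P2 x * F x ∂nu) • tensor n := by
  ext i j
  have h := integral_dot_mul_traceless hF n (EuclideanSpace.single i 1)
    (EuclideanSpace.single j 1)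
  have hδ : inner ℝ (EuclideanSpace.single i (1 : ℝ) : EuclideanSpace ℝ (Fin 3))
      (EuclideanSpace.single j 1) / 3 = if i = j then (1 / 3 : ℝ) else 0 := by
    rw [EuclideanSpace.inner_single_left]
    by_cases hij : i = j
    · simp [hij]
    · simp [hij]
  rw [hδ] at h
  simp only [EuclideanSpace.inner_single_right, one_mul, conj_trivial] at h
  simp only [moment, Matrix.smul_apply, smul_eq_mul, tensor]
  rw [h]
  ring

theorem UniaxialELWith.biaxialEL {η : ℝ} {h : ℝ → ℝ} {Z S l : ℝ} (hE : UniaxialELWith η h Z S l)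
    (n : S2) : BiaxialELWith η (axial h n) (2 * Real.pi * Z) (S • tensor n)
      ((3 / 2 * l) • tensor n) := by
  have hi := hE.density.integrable
  have hq : ∀ p : S2, quadForm (S • tensor n) p = 2 / 3 * S * P2 (dot p n) := fun p =>
    quadForm_smul_tensor S n p
  have hquot : Integrable (fun x => h x / (2 / 3 * S * P2 x - η)) nu := by
    have hm : Measurable fun x => Z⁻¹ * Real.exp (l * P2 x) * max (2 / 3 * S * P2 x - η) 0 /
        (2 / 3 * S * P2 x - η) := by fun_prop
    have hb := integrable_nu_of_bound hm (Z⁻¹ * Real.exp |l|) fun x hx => by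
      have h1 : |max (2 / 3 * S * P2 x - η) 0 / (2 / 3 * S * P2 x - η)| ≤ 1 := by
        rw [abs_div]
        refine div_le_one_of_le₀ ?_ (abs_nonneg _)
        rw [abs_of_nonneg (le_max_right _ _)]
        exact max_le (le_abs_self _) (abs_nonneg _)
      have h2 : Real.exp (l * P2 x) ≤ Real.exp |l| := by
        refine Real.exp_le_exp.2 ((le_abs_self _).trans ?_)
        rw [abs_mul]
        nlinarith [abs_P2_le hx, abs_nonneg l]
      have hZ := inv_pos.2 hE.Z_pos
      rw [mul_div_assoc, abs_mul, abs_of_pos (mul_pos hZ (Real.exp_pos _))]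
      calc Z⁻¹ * Real.exp (l * P2 x) * _ ≤ Z⁻¹ * Real.exp |l| * 1 := by gcongr
        _ = _ := mul_one _
    refine hb.congr ?_
    filter_upwards [ae_mem_nu] with x hx
    rw [hE.eq_h x hx]
  have hS := hE.eq_S
  have hl := hE.eq_l
  rw [intervalIntegral_eq_nu] at hS hl
  refine ⟨mul_pos (by positivity) hE.Z_pos, isSymm_smul_tensor _ _, trace_smul_tensor _ _,
    isSymm_smul_tensor _ _, trace_smul_tensor _ _, fun p => ?_, ?_, ?_⟩
  · rw [hq, quadForm_smul_tensor, axial, hE.eq_h _ (dot_mem_Icc p n), mul_inv]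
    have : 2 / 3 * (3 / 2 * l) = l := by ring
    rw [this]; ring
  · have h1 := moment_dot (hi.const_mul (2 * Real.pi)⁻¹) n
    have h2 : ∫ x, P2 x * ((2 * Real.pi)⁻¹ * h x) ∂nu = (2 * Real.pi)⁻¹ * S := by
      rw [hS, ← integral_const_mul]
      congr 1; ext x; ring
    rw [h2, mul_inv_cancel_left₀ (by positivity)] at h1
    exact h1.symm
  · have h1 := moment_dot (hquot.const_mul (2 * Real.pi)⁻¹) n
    have h2 : ∫ x, P2 x * ((2 * Real.pi)⁻¹ * (h x / (2 / 3 * S * P2 x - η))) ∂nu =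
        (2 * Real.pi)⁻¹ * (3 / 2 * l) := by
      have h3 : ∫ x, P2 x * ((2 * Real.pi)⁻¹ * (h x / (2 / 3 * S * P2 x - η))) ∂nu =
          (2 * Real.pi)⁻¹ * ∫ x, P2 x * (h x / (2 / 3 * S * P2 x - η)) ∂nu := by
        rw [← integral_const_mul]
        congr 1; ext x; ring
      rw [h3]
      linear_combination (-(3 / 2) * (2 * Real.pi)⁻¹) * hl
    rw [h2, mul_inv_cancel_left₀ (by positivity)] at h1
    rw [← h1]
    congr 1
    ext p
    rw [hq, axial, mul_div_assoc]

end Nematic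

theorem mainTheorem9 (η : ℝ) :
    (∀ r : ℝ≥0∞, 1 ≤ r → ∀ f : Nematic.S2 → ℝ, Nematic.IsUniaxialLocalMin η r f →
      ∃ (h : ℝ → ℝ) (n : Nematic.S2), Nematic.UniaxialEL η h ∧
        ∀ᵐ p ∂Nematic.surf, f p = Nematic.axial h n p) ∧
    (∀ h : ℝ → ℝ, Nematic.UniaxialEL η h → ∀ n : Nematic.S2,
      Nematic.IsProbDensity Nematic.surf (Nematic.axial h n) ∧
        Nematic.BiaxialEL η (Nematic.axial h n)) := by
  refine ⟨fun r _ f hf => hf.exists_uniaxialEL, fun h hh n => ?_⟩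
  obtain ⟨Z, S, l, hE⟩ := hh
  exact ⟨Nematic.isProbDensity_axial hE.density n, _, _, _, hE.biaxialEL n⟩
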